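/- **Model.** Let $G$ be a simple undirected graph with $n$ nodes $V$. In the synchronous CONGEST model with bandwidth $B = b\lceil \log_2 n\rceil$ (with $b\ge 1$ a constant), in each round every node sends a $B$-bit message to each of its neighbours and then updates its state from the messages it received; local computation is free. In a randomized algorithm each node also has private coins, independent of those of the other nodes. **Core-periphery networks.** Let $V=\mathcal C\sqcup\mathcal P$ be a partition into a core and a periphery. The network is a *core-periphery network* with constants $\alpha,\beta,\gamma$ if * every $v\in\mathcal C$ satisfies $d_{\mathrm{out}}(v)/(d_{\mathrm{in}}(v)+1)\le\alpha$, where $d_{\mathrm{in}}(v)$ and $d_{\mathrm{out}}(v)$ are the numbers of neighbours of $v$ inside and outside $\mathcal C$; * on the subgraph induced by $\mathcal C$, some CONGEST algorithm delivers, for arbitrary $B$-bit messages $M_{v,w}$ (initially known to $v$), the message $M_{v,w}$ to $w$ for all pairs $v,w\in\mathcal C$ within $\beta$ rounds; * on $G$, some CONGEST algorithm makes, for arbitrary $B$-bit messages $M_v$ held by the nodes $v\in\mathcal P$, each $M_v$ reach at least one node of $\mathcal C$ within $\gamma$ rounds. **Task.** Let $A$ be an $n\times n$ matrix and $s$ a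 vector of size $n$ over a semiring $R$, all of whose entries lie in a set $D\subseteq R$ with $|D|\le 2^{d\lceil\log_2 n\rceil}$, i.e. are representable by $O(\log n)$ bits. Let every row and every column of $A$ have at most $qk$ nonzero entries (so $A$ is $O(k)$-sparse). Initially each node holds one entry of $s$ and one row of $A$, each along with its index, distributed by two arbitrary bijections between the nodes and the indices. The task is to compute $s'=sA$ so that the node that initially held $s(i)$ finally stores $s'(i)$. **Theorem.** For every real $\alpha$, all nonnegative integers $\beta,\gamma,d,q,a$ and every integer $b\ge 1$ there is a constant $K$ such that for every $n$, every $n$-node core-periphery network with constants $\alpha,\beta,\gamma$, every semiring $R$ with a set $D$ as above, and every $k$, there is a randomized CONGEST algorithm (which may depend on the network, on $R$, $D$ and on $k$, but not on the input) that on every input solves the task within $Kk$ rounds with probability at least $1-n^{-a}$. -/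

import Mathlib

open scoped Matrix

universe u

/-- A message of `B` bits. -/
abbrev Msg (B : ℕ) : Type := Fin B → Bool

/-- A distributed algorithm in the synchronous CONGEST model on the network `G`, with bandwidth
`B` bits per edge, direction and round. Every node `v` has its own program. It starts from its own
input and its own private coins only; in each round it computes from its state one message for
each of its neighbours, and then updates its state from the messages that it received.
Local computation and local memory are unrestricted. -/
structure CongestAlgorithm {V : Type u} (G : SimpleGraph V) (B : ℕ)
    (In : Type u) (Coin : Type) (Out : Type u) where
  /-- local states of the nodes -/
  State : Type u
  /-- the initial state of a node -/
  init : V → In → Coin → State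
  /-- `send v w x` is the message sent by `v` in state `x` to its neighbour `w` -/
  send : (v : V) → G.neighborSet v → State → Msg B
  /-- the new state of a node, from its old state and the messages received from its neighbours -/
  update : (v : V) → State → (G.neighborSet v → Msg B) → State
  /-- the output of a node, read off from its state -/
  out : V → State → Out

namespace CongestAlgorithm

variable {V : Type u} {G : SimpleGraph V} {B : ℕ} {In : Type u} {Coin : Type} {Out : Type u}

/-- The states of all nodes after `t` synchronous rounds. -/
def run (𝒜 : CongestAlgorithm G B In Coin Out) (inp : V → In) (ω : V → Coin) :
    ℕ → V → 𝒜.State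
  | 0 => fun v => 𝒜.init v (inp v) (ω v)
  | t + 1 => fun v => 𝒜.update v (𝒜.run inp ω t v)
      (fun w => 𝒜.send w.1 ⟨v, w.2.symm⟩ (𝒜.run inp ω t w.1))

/-- The output of the node `v` after `t` rounds. -/
def output (𝒜 : CongestAlgorithm G B In Coin Out) (inp : V → In) (ω : V → Coin)
    (t : ℕ) (v : V) : Out :=
  𝒜.out v (𝒜.run inp ω t v)

end CongestAlgorithm

/-- The probability that `E` holds for the private coins of the nodes, which are independent and
uniformly distributed on the finite type `Coin`. -/
noncomputable def coinProb {V : Type u} {Coin : Type} (E : (V → Coin) → Prop) : ℝ :=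
  (Nat.card {ω : V → Coin // E ω} : ℝ) / (Nat.card (V → Coin) : ℝ)

/-- The number of neighbours of `v` inside `S`. -/
noncomputable def degIn {V : Type u} (G : SimpleGraph V) (S : Set V) (v : V) : ℕ :=
  (G.neighborSet v ∩ S).ncard

/-- The number of neighbours of `v` outside `S`. -/
noncomputable def degOut {V : Type u} (G : SimpleGraph V) (S : Set V) (v : V) : ℕ :=
  (G.neighborSet v ∩ Sᶜ).ncard

/-- `S` has an `α`-balanced boundary. -/
def HasBalancedBoundary {V : Type u} (G : SimpleGraph V) (S : Set V) (α : ℝ) : Prop :=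
  ∀ v ∈ S, (degOut G S v : ℝ) / ((degIn G S v : ℝ) + 1) ≤ α

/-- `G` is a `β`-clique-emulator: some deterministic CONGEST algorithm delivers, within `β` rounds
and whatever the contents are, a message `M v w` from `v` to `w` for every pair of nodes. Initially
`v` knows the messages `M v w` that it has to send and nothing else; finally `w` knows, for every
`v`, the message `M v w`. -/
def IsCliqueEmulator {V : Type u} (G : SimpleGraph V) (B β : ℕ) : Prop :=
  ∃ 𝒜 : CongestAlgorithm G B (V → Msg B) Unit (V → Msg B),
    ∀ (M : V → V → Msg B) (v w : V), 𝒜.output M (fun _ => ()) β w v = M v w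

open Classical in
/-- `S` and `T` form a `γ`-convergecaster in `G`: some deterministic CONGEST algorithm on `G` makes,
within `γ` rounds and whatever the contents are, the message `M v` of every node `v ∈ S` reach at
least one node of `T`. The output of a node `t ∈ T` lists, for each source `v`, the message of `v`
if it has reached `t`, and `none` otherwise; a listed message has to be the right one. -/
def IsConvergecaster {V : Type u} (G : SimpleGraph V) (S T : Set V) (B γ : ℕ) : Prop :=
  ∃ 𝒜 : CongestAlgorithm G B (ULift.{u} (Option (Msg B))) Unit (V → Option (Msg B)),
    ∀ (M : V → Msg B) (v : V), v ∈ S →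
      let result : V → V → Option (Msg B) :=
        𝒜.output (fun x => ⟨if x ∈ S then some (M x) else none⟩) (fun _ => ()) γ
      (∃ t ∈ T, result t v = some (M v)) ∧
        ∀ t ∈ T, ∀ m : Msg B, result t v = some m → m = M v

/-- The network `G` with core `C` and periphery `Cᶜ` is a core-periphery network, with constants
`α`, `β`, `γ`, in the CONGEST model with `B`-bit messages. -/
structure IsCorePeriphery {V : Type u} (G : SimpleGraph V) (C : Set V)
    (α : ℝ) (β γ B : ℕ) : Prop where
  /-- the core has an `α`-balanced boundary -/
  boundary : HasBalancedBoundary G C α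
  /-- the core is a `β`-clique-emulator -/
  emulation : IsCliqueEmulator (G.induce C) B β
  /-- the periphery and the core form a `γ`-convergecaster -/
  convergecast : IsConvergecaster G Cᶜ C B γ

/-- Every row and every column of `A` has at most `m` nonzero entries. -/
def IsSparse {n : ℕ} {R : Type u} [Zero R] (m : ℕ) (A : Matrix (Fin n) (Fin n) R) : Prop :=
  (∀ i, {j | A i j ≠ 0}.ncard ≤ m) ∧ ∀ j, {i | A i j ≠ 0}.ncard ≤ m

/-- What a node holds initially in vector by matrix multiplication: one entry of the vector and
one row of the matrix, each along with its index. -/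
structure VMMInput (n : ℕ) (R : Type u) : Type u where
  entryIdx : Fin n
  entry : R
  rowIdx : Fin n
  row : Fin n → R

/-- The initial data: node `v` holds the entry of `s` with index `σ v` and the row of `A` with
index `τ v`. -/
def vmmInput {V : Type u} {n : ℕ} {R : Type u} (σ τ : V ≃ Fin n) (s : Fin n → R)
    (A : Matrix (Fin n) (Fin n) R) (v : V) : VMMInput n R :=
  ⟨σ v, s (σ v), τ v, A (τ v)⟩

/-- After `T` rounds, for the coins `ω`, every node stores the entry of the vector `s A` whose index
is that of the entry of `s` which it held initially. -/
def SolvesVMM {V : Type u} {G : SimpleGraph V} {B n : ℕ} {R : Type u} [Semiring R] {Coin : Type}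
    (𝒜 : CongestAlgorithm G B (VMMInput n R) Coin R) (σ τ : V ≃ Fin n) (s : Fin n → R)
    (A : Matrix (Fin n) (Fin n) R) (T : ℕ) (ω : V → Coin) : Prop :=
  ∀ v : V, 𝒜.output (vmmInput σ τ s A) ω T v = (s ᵥ* A) (σ v)

/-! No coins are needed: a deterministic algorithm solves the task. Local computation being free,
only the flow of information matters. The knowledge of a node is the equivalence relation
"indistinguishable for this node" on global inputs; a message must be constant on the classes of its
sender, and hearing it refines the relation of its receiver. `Learn.exists_algorithm` turns such a
process into an algorithm.

Clique. If a fixed pattern makes every node of a clique `N` send and receive at most `D * |N|`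
messages, `O(D)` rounds suffice: colour the edges of the bipartite multigraph of sources and
destinations, and read a colour as a pair of a round and a relay node (`delivers_static`). If the
pattern depends on the input, nobody knows this multigraph. In an `r × r` grid (`learn_route`),
every node therefore first spreads its packets for each destination row evenly over its own row.
Then every column holds `O(D * r ^ 2)` packets for each row, and it remains to route inside columns
and then inside rows. The `r` members of a row or column can announce all their counts in `O(1)`
messages per pair of grid nodes, whereupon they all compute the same colouring.

Periphery. A convergecast algorithm may mix messages arbitrarily, but counting transcripts across a
cut (`card_le_of_isConvergecaster`) proves Hall's condition, and a matching yields routes into the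
core no two of which use an edge in the same direction and round (`exists_schedule`). At most `γ *
degOut c + 1` of them end at `c`, which is `O(|C|)` by the balanced boundary. Hence `n = O(|C| ^
2)`, and a grid of at least `|C| / 4` core nodes can host all nodes of the network, `O(r ^ 2)` per
grid node (`exists_hosting`).

Product. The host of index `i` collects `s i` and row `i`, and sends the pair `(s i, A i j)` to the
host of `j` for each nonzero `A i j`; sparsity bounds this load by `O(k * r ^ 2)`. The list of pairs
at `j` then travels to the node that wants entry `j`, which does the arithmetic itself. Pairs
travel, not products or partial sums, because only elements of `D` are known to be short. -/

/-! ### Knowledge of the nodes -/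

namespace CorePeriphery

variable {N Ω X Y : Type*} {B : ℕ}

/-- What the nodes know after one round, in which `v` sends `μ v w` to `w`, if they know `K`
before: two global inputs are related at `w` if `w` cannot tell them apart. -/
def hear (G : SimpleGraph N) (K : N → Setoid Ω) (μ : N → N → Ω → Msg B) (w : N) : Setoid Ω :=
  K w ⊓ Setoid.ker (fun ω (v : {v // G.Adj v w}) => μ v.1 w ω)

/-- From the knowledge `K`, the nodes can acquire at least the knowledge `K'` in `T` rounds. -/
def Learn (G : SimpleGraph N) (B : ℕ) : ℕ → (N → Setoid Ω) → (N → Setoid Ω) → Prop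
  | 0, K, K' => K ≤ K'
  | T + 1, K, K' => ∃ μ : N → N → Ω → Msg B,
      (∀ v w, G.Adj v w → K v ≤ Setoid.ker (μ v w)) ∧ Learn G B T (hear G K μ) K'

theorem hear_mono {G : SimpleGraph N} {K₁ K₂ : N → Setoid Ω} (h : K₁ ≤ K₂)
    (μ : N → N → Ω → Msg B) : hear G K₁ μ ≤ hear G K₂ μ :=
  fun w => inf_le_inf_right _ (h w)

theorem hear_le (G : SimpleGraph N) (K : N → Setoid Ω) (μ : N → N → Ω → Msg B) :
    hear G K μ ≤ K :=
  fun _ => inf_le_left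

namespace Learn

variable {G : SimpleGraph N} {S T : ℕ} {K K' K₁ K₂ : N → Setoid Ω}

theorem anti (h : Learn G B T K K') (hK : K₁ ≤ K) : Learn G B T K₁ K' := by
  induction T generalizing K K₁ with
  | zero => exact hK.trans h
  | succ T ih =>
    obtain ⟨μ, hμ, h⟩ := h
    exact ⟨μ, fun v w hvw => (hK v).trans (hμ v w hvw), ih h (hear_mono hK μ)⟩

theorem mono (h : Learn G B T K K₁) (hK : K₁ ≤ K') : Learn G B T K K' := by
  induction T generalizing K with
  | zero => exact le_trans h hK
  | succ T ih =>
    obtain ⟨μ, hμ, h⟩ := h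
    exact ⟨μ, hμ, ih h⟩

theorem trans (h : Learn G B S K K₁) (h' : Learn G B T K₁ K') : Learn G B (S + T) K K' := by
  induction S generalizing K with
  | zero => rw [zero_add]; exact h'.anti h
  | succ S ih =>
    obtain ⟨μ, hμ, h⟩ := h
    rw [Nat.add_right_comm]
    exact ⟨μ, hμ, ih h⟩

theorem keep (h : Learn G B T K K') : Learn G B T K (K ⊓ K') := by
  induction T generalizing K with
  | zero => exact le_inf le_rfl h
  | succ T ih =>
    obtain ⟨μ, hμ, h⟩ := h
    exact ⟨μ, hμ, (ih h).mono (inf_le_inf_right _ (hear_le G K μ))⟩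

/-- The two tasks are run one after the other; memory is unlimited, so the second still has the
initial knowledge at its disposal. -/
theorem par (h₁ : Learn G B S K K₁) (h₂ : Learn G B T K K₂) :
    Learn G B (S + T) K (K₁ ⊓ K₂) :=
  h₁.keep.trans ((h₂.anti inf_le_left).keep.mono (inf_le_inf_right _ inf_le_right))

theorem of_le (h : K ≤ K') (T : ℕ) : Learn G B T K K' := by
  induction T generalizing K with
  | zero => exact h
  | succ T ih =>
    exact ⟨fun _ _ _ _ => false, fun _ _ _ _ _ _ => rfl, ih ((hear_le G K _).trans h)⟩

theorem mono_time (h : Learn G B S K K') (hST : S ≤ T) : Learn G B T K K' := by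
  obtain ⟨r, rfl⟩ := Nat.exists_eq_add_of_le hST
  exact h.trans (of_le le_rfl r)

theorem single {μ : N → N → Ω → Msg B} (hμ : ∀ v w, G.Adj v w → K v ≤ Setoid.ker (μ v w)) :
    Learn G B 1 K (hear G K μ) :=
  ⟨μ, hμ, le_rfl⟩

/-- The messages and the knowledge in each round of a way to learn. -/
theorem exists_rounds (h : Learn G B T K K') :
    ∃ (κ : ℕ → N → Setoid Ω) (μ : ℕ → N → N → Ω → Msg B), κ 0 = K ∧
      (∀ t, κ (t + 1) = hear G (κ t) (μ t)) ∧
      (∀ t v w, G.Adj v w → κ t v ≤ Setoid.ker (μ t v w)) ∧ κ T ≤ K' := by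
  induction T generalizing K with
  | zero =>
    -- Beyond the last round the sequences continue with constant messages, so that they are defined
    -- for all `t`.
    exact ⟨fun t => (fun κ => hear G κ fun _ _ _ _ => false)^[t] K,
      fun _ _ _ _ _ => false, rfl, fun t => Function.iterate_succ_apply' _ t K,
      fun _ _ _ _ _ _ _ => rfl, h⟩
  | succ T ih =>
    obtain ⟨μ, hμ, h⟩ := h
    obtain ⟨κ, ν, h0, hs, hk, hT⟩ := ih h
    refine ⟨fun t => Nat.casesOn t K κ, fun t => Nat.casesOn t μ ν, rfl, ?_, ?_, hT⟩
    · rintro (_ | t)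
      · exact h0
      · exact hs t
    · rintro (_ | t)
      · exact hμ
      · exact hk t

end Learn

/-- Everything that can be learnt can be computed by an algorithm: its local states consist of the
round number and the set of the inputs that are consistent with what the node has seen. -/
theorem Learn.exists_algorithm {V : Type u} {Ω In Out : Type u} [Inhabited Out]
    {G : SimpleGraph V} {T : ℕ} {inp : Ω → V → In} {K' : V → Setoid Ω}
    (h : Learn G B T (fun v => Setoid.ker fun ω => inp ω v) K')
    (out : V → Ω → Out) (hout : ∀ v, K' v ≤ Setoid.ker (out v)) :
    ∃ 𝒜 : CongestAlgorithm G B In Unit Out,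
      ∀ ω c v, 𝒜.output (inp ω) c T v = out v ω := by
  classical
  obtain ⟨κ, μ, h0, hs, hk, hT⟩ := h.exists_rounds
  let 𝒜 : CongestAlgorithm G B In Unit Out :=
    { State := ℕ × Set Ω
      init := fun v i _ => (0, {ω | inp ω v = i})
      send := fun v w x => if h : x.2.Nonempty then μ x.1 v w.1 h.some else fun _ => false
      update := fun v x m => (x.1 + 1, {ω ∈ x.2 | ∀ w : G.neighborSet v, μ x.1 w.1 v ω = m w})
      out := fun v x => if h : x.2.Nonempty then out v h.some else default }
  -- The set stored by `v` is exactly the class of the true input, so any representative of it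
  -- yields the right message.
  have hrun : ∀ ω c t v, 𝒜.run (inp ω) c t v = (t, {ω' | κ t v ω' ω}) := by
    intro ω c t
    induction t with
    | zero =>
      intro v
      rw [h0]
      rfl
    | succ t ih =>
      intro v
      have hne : ∀ w, ({ω' | κ t w ω' ω} : Set Ω).Nonempty := fun w => ⟨ω, (κ t w).refl' ω⟩
      have hsend : ∀ w : G.neighborSet v,
          𝒜.send w.1 ⟨v, w.2.symm⟩ (t, {ω' | κ t w.1 ω' ω}) = μ t w.1 v ω := by
        intro w
        simp only [𝒜, dif_pos (hne w.1)]
        exact hk t w.1 v w.2.symm (hne w.1).some_mem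
      simp only [CongestAlgorithm.run, ih, hsend]
      rw [hs]
      refine Prod.ext rfl (Set.ext fun ω' => ?_)
      change (κ t v ω' ω ∧ _) ↔ (κ t v ω' ω ∧ (fun w : {w // G.Adj w v} => μ t w.1 v ω') =
        fun w : {w // G.Adj w v} => μ t w.1 v ω)
      rw [funext_iff, Subtype.forall, Subtype.forall]
      exact and_congr_right fun _ =>
        ⟨fun H w hw => H w hw.symm, fun H w hw => H w (SimpleGraph.Adj.symm hw)⟩
  refine ⟨𝒜, fun ω c v => ?_⟩
  have hne : ({ω' | κ T v ω' ω} : Set Ω).Nonempty := ⟨ω, (κ T v).refl' ω⟩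
  simp only [CongestAlgorithm.output, hrun, 𝒜, dif_pos hne]
  exact hout v (hT v hne.some_mem)

/-! ### Delivery of messages along fixed pairs of nodes -/

/-- Knowing the values `f i`, for all `i` with `dst i = w`. -/
def gather {I : Type*} (dst : I → N) (f : I → Ω → X) (w : N) : Setoid Ω :=
  Setoid.ker fun ω (i : {i // dst i = w}) => f i.1 ω

theorem gather_le {I : Type*} {dst : I → N} {f : I → Ω → X} (i : I) :
    gather dst f (dst i) ≤ Setoid.ker (f i) :=
  fun _ _ h => congrFun h ⟨i, rfl⟩

theorem le_gather {I : Type*} {dst : I → N} {f : I → Ω → X} {K : Setoid Ω} {w : N}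
    (h : ∀ i, dst i = w → K ≤ Setoid.ker (f i)) : K ≤ gather dst f w :=
  fun _ _ hxy => funext fun i => h i.1 i.2 hxy

/-- `B`-bit messages, one for each index `i`, can be delivered from `src i` to `dst i` within `T`
rounds. -/
def Delivers (Ω : Type*) {I : Type*} (G : SimpleGraph N) (B T : ℕ) (src dst : I → N) : Prop :=
  ∀ (K : N → Setoid Ω) (f : I → Ω → Msg B), (∀ i, K (src i) ≤ Setoid.ker (f i)) →
    Learn G B T K (gather dst f)

namespace Delivers

variable {I J : Type*} {G : SimpleGraph N} {S T : ℕ} {src mid dst : I → N}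

theorem trans (h : Delivers Ω G B S src mid) (h' : Delivers Ω G B T mid dst) :
    Delivers Ω G B (S + T) src dst :=
  fun K f hf => (h K f hf).trans (h' _ f fun i => gather_le i)

theorem mono_time (h : Delivers Ω G B S src dst) (hST : S ≤ T) : Delivers Ω G B T src dst :=
  fun K f hf => (h K f hf).mono_time hST

/-- The indices outside the range of `e` carry a constant message. -/
theorem comp (h : Delivers Ω G B T src dst) (e : J → I) (he : e.Injective) :
    Delivers Ω G B T (src ∘ e) (dst ∘ e) := by
  classical
  intro K f hf
  let g : I → Ω → Msg B := fun i => if h : ∃ j, e j = i then f h.choose else fun _ _ => false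
  have hg : ∀ j, g (e j) = f j := fun j => by
    have hj : ∃ j', e j' = e j := ⟨j, rfl⟩
    simp only [g, dif_pos hj]
    rw [he hj.choose_spec]
  refine (h K g fun i => ?_).mono fun w => le_gather fun j hj => ?_
  · by_cases hi : ∃ j, e j = i
    · obtain ⟨j, rfl⟩ := hi
      rw [hg]
      exact hf j
    · simp only [g, dif_neg hi]
      exact fun _ _ _ => rfl
  · subst hj
    rw [← hg]
    exact gather_le (e j)

theorem vector (h : Delivers Ω G B T src dst) (c : ℕ) (K : N → Setoid Ω)
    (f : I → Ω → Fin c → Msg B) (hf : ∀ i, K (src i) ≤ Setoid.ker (f i)) :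
    Learn G B (c * T) K (gather dst f) := by
  induction c with
  | zero => exact Learn.of_le (fun w => le_gather fun i _ _ _ _ => funext fun l => l.elim0) _
  | succ c ih =>
    rw [Nat.succ_mul]
    refine ((ih (fun i ω l => f i ω l.castSucc) fun i _ _ hxy => ?_).par
      (h K (fun i ω => f i ω (Fin.last c)) fun i _ _ hxy => ?_)).mono fun w => ?_
    · exact funext fun l => congrFun (hf i hxy) _
    · exact congrFun (hf i hxy) _
    · refine le_gather fun i hi => ?_
      subst hi
      intro x y hxy
      refine funext fun l => ?_
      induction l using Fin.lastCases with
      | last => exact gather_le i hxy.2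
      | cast l => exact congrFun (gather_le i hxy.1) l

/-- Larger messages are cut into pieces. -/
theorem large [Finite X] (h : Delivers Ω G B T src dst) {c : ℕ} (hX : Nat.card X ≤ 2 ^ (B * c))
    (K : N → Setoid Ω) (f : I → Ω → X) (hf : ∀ i, K (src i) ≤ Setoid.ker (f i)) :
    Learn G B (c * T) K (gather dst f) := by
  have hX' : Nat.card X ≤ Nat.card (Fin c → Msg B) := by
    simpa [Nat.card_eq_fintype_card, ← pow_mul] using hX
  obtain ⟨enc⟩ : Nonempty (X ↪ (Fin c → Msg B)) := by
    have := Fintype.ofFinite X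
    rw [Nat.card_eq_fintype_card, Nat.card_eq_fintype_card] at hX'
    exact Function.Embedding.nonempty_of_card_le hX'
  refine (h.vector c K (fun i ω => enc (f i ω)) fun i _ _ hxy => congrArg enc (hf i hxy)).mono
    fun w => le_gather fun i hi => ?_
  subst hi
  exact fun x y hxy => enc.injective (gather_le i hxy)

end Delivers

end CorePeriphery

/-! ### Communication in a clique -/

namespace CorePeriphery

variable {N Ω X P I : Type*} {B : ℕ}

/-- Greedy edge colouring of a bipartite multigraph. -/
theorem exists_edge_colouring {E A A' : Type*} [Finite E] (a : E → A) (b : E → A') (Δ : ℕ)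
    (ha : ∀ x, {e | a e = x}.ncard ≤ Δ) (hb : ∀ y, {e | b e = y}.ncard ≤ Δ) :
    ∃ col : E → Fin (2 * Δ), ∀ e e', e ≠ e' → col e = col e' → a e ≠ a e' ∧ b e ≠ b e' := by
  classical
  have := Fintype.ofFinite E
  rcases isEmpty_or_nonempty E with hE | ⟨⟨e₀⟩⟩
  · exact ⟨fun e => (hE.false e).elim, fun e => (hE.false e).elim⟩
  have hΔ : 0 < 2 * Δ := by
    have : 0 < {e | a e = a e₀}.ncard := (Set.ncard_pos (Set.toFinite _)).2 ⟨e₀, rfl⟩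
    have := ha (a e₀)
    omega
  have key : ∀ s : Finset E, ∃ col : E → Fin (2 * Δ), ∀ e ∈ s, ∀ e' ∈ s, e ≠ e' →
      col e = col e' → a e ≠ a e' ∧ b e ≠ b e' := by
    intro s
    induction s using Finset.induction_on with
    | empty => exact ⟨fun _ => ⟨0, hΔ⟩, by simp⟩
    | insert e s hes ih =>
      obtain ⟨col, hcol⟩ := ih
      let S : Finset E := s.filter fun e' => a e' = a e
      let S' : Finset E := s.filter fun e' => b e' = b e
      have hS : S.card < Δ := by
        refine lt_of_lt_of_le ?_ (ha (a e))
        rw [← Set.ncard_coe_finset]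
        refine Set.ncard_lt_ncard ⟨fun x hx => (Finset.mem_filter.1 hx).2, fun h => ?_⟩
          (Set.toFinite _)
        exact hes (Finset.mem_filter.1 (h (show a e = a e from rfl))).1
      have hS' : S'.card < Δ := by
        refine lt_of_lt_of_le ?_ (hb (b e))
        rw [← Set.ncard_coe_finset]
        refine Set.ncard_lt_ncard ⟨fun x hx => (Finset.mem_filter.1 hx).2, fun h => ?_⟩
          (Set.toFinite _)
        exact hes (Finset.mem_filter.1 (h (show b e = b e from rfl))).1
      -- The new edge meets fewer than `Δ` coloured edges at either end, so one of the `2 * Δ`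
      -- colours is free.
      obtain ⟨c, -, hc⟩ : ∃ c ∈ (Finset.univ : Finset (Fin (2 * Δ))), c ∉ (S ∪ S').image col := by
        refine Finset.exists_mem_notMem_of_card_lt_card ?_
        rw [Finset.card_univ, Fintype.card_fin]
        have h1 := Finset.card_image_le (s := S ∪ S') (f := col)
        have h2 := Finset.card_union_le S S'
        omega
      have hc' : ∀ e' ∈ s, col e' = c → a e' ≠ a e ∧ b e' ≠ b e := by
        intro e' he' hcc
        constructor
        · intro h
          exact hc (Finset.mem_image.2
            ⟨e', Finset.mem_union_left _ (Finset.mem_filter.2 ⟨he', h⟩), hcc⟩)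
        · intro h
          exact hc (Finset.mem_image.2
            ⟨e', Finset.mem_union_right _ (Finset.mem_filter.2 ⟨he', h⟩), hcc⟩)
      refine ⟨Function.update col e c, fun x hx y hy hxy h => ?_⟩
      have hx' := hx
      rcases Finset.mem_insert.1 hx with rfl | hx
      · have hy := (Finset.mem_insert.1 hy).resolve_left hxy.symm
        rw [Function.update_self, Function.update_of_ne hxy.symm] at h
        exact ⟨(hc' y hy h.symm).1.symm, (hc' y hy h.symm).2.symm⟩
      · rcases Finset.mem_insert.1 hy with rfl | hy
        · rw [Function.update_self, Function.update_of_ne hxy] at h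
          exact hc' x ((Finset.mem_insert.1 hx').resolve_left hxy) h
        · rw [Function.update_of_ne (ne_of_mem_of_not_mem hx hes),
            Function.update_of_ne (ne_of_mem_of_not_mem hy hes)] at h
          exact hcol x hx y hy hxy h
  obtain ⟨col, hcol⟩ := key Finset.univ
  exact ⟨col, fun e e' => hcol e (Finset.mem_univ _) e' (Finset.mem_univ _)⟩

/-- An edge colouring in which the colours are pairs of a small number and a node. -/
theorem exists_relay_colouring {E A A' : Type*} [Finite E] [Finite N] (a : E → A) (b : E → A')
    (D : ℕ) (ha : ∀ x, {e | a e = x}.ncard ≤ D * Nat.card N)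
    (hb : ∀ y, {e | b e = y}.ncard ≤ D * Nat.card N) :
    ∃ col : E → Fin (2 * D) × N, ∀ e e', e ≠ e' → col e = col e' → a e ≠ a e' ∧ b e ≠ b e' := by
  obtain ⟨col, hcol⟩ := exists_edge_colouring a b _ ha hb
  have := Fintype.ofFinite N
  have e : Fin (2 * (D * Nat.card N)) ≃ Fin (2 * D) × N :=
    Fintype.equivOfCardEq (by simp [Nat.card_eq_fintype_card, mul_assoc])
  exact ⟨fun i => e (col i), fun i j hij h => hcol i j hij (e.injective h)⟩

theorem delivers_one {src dst : I → N}
    (h : ∀ i j, src i = src j → dst i = dst j → i = j) :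
    Delivers Ω (⊤ : SimpleGraph N) B 1 src dst := by
  classical
  intro K f hf
  let μ : N → N → Ω → Msg B := fun v w =>
    if h : ∃ i, src i = v ∧ dst i = w then f h.choose else fun _ _ => false
  have hμ : ∀ i, μ (src i) (dst i) = f i := by
    intro i
    have hi : ∃ j, src j = src i ∧ dst j = dst i := ⟨i, rfl, rfl⟩
    simp only [μ, dif_pos hi]
    rw [h _ _ hi.choose_spec.1 hi.choose_spec.2]
  refine (Learn.single (μ := μ) fun v w _ => ?_).mono fun w => le_gather fun i hi => ?_
  · by_cases hvw : ∃ i, src i = v ∧ dst i = w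
    · obtain ⟨i, rfl, rfl⟩ := hvw
      rw [hμ]
      exact hf i
    · simp only [μ, dif_neg hvw]
      exact fun _ _ _ => rfl
  · subst hi
    -- The clique has no loops, but a message to oneself needs no edge.
    by_cases hii : src i = dst i
    · exact (hear_le _ _ _ _).trans (hii ▸ hf i)
    · intro x y hxy
      have := congrFun hxy.2 ⟨src i, hii⟩
      simp only [hμ] at this
      exact this

/-- Direct delivery, if at most one message for each `rank` has to use an edge. -/
theorem delivers_direct {src dst : I → N} {L : ℕ} (rank : I → Fin L)
    (h : ∀ i j, rank i = rank j → src i = src j → dst i = dst j → i = j) :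
    Delivers Ω (⊤ : SimpleGraph N) B L src dst := by
  intro K f hf
  have key : ∀ n : ℕ, Learn (⊤ : SimpleGraph N) B n K
      (gather (fun i : {i // (rank i : ℕ) < n} => dst i) fun i => f i) := by
    intro n
    induction n with
    | zero => exact fun w => le_gather fun i => absurd i.2 (Nat.not_lt_zero _)
    | succ n ih =>
      have h1 : Delivers Ω (⊤ : SimpleGraph N) B 1
          (fun i : {i // (rank i : ℕ) = n} => src i) (fun i => dst i) :=
        delivers_one fun i j hs hd =>
          Subtype.ext (h i j (Fin.ext (i.2.trans j.2.symm)) hs hd)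
      refine (ih.par (h1 K (fun i => f i) fun i => hf i)).mono fun w => le_gather fun i hi => ?_
      subst hi
      rcases Nat.lt_succ_iff_lt_or_eq.1 i.2 with hlt | heq
      · exact inf_le_left.trans (gather_le (dst := fun i : {i // (rank i : ℕ) < n} => dst i)
          (f := fun i => f i) ⟨i.1, hlt⟩)
      · exact inf_le_right.trans (gather_le (dst := fun i : {i // (rank i : ℕ) = n} => dst i)
          (f := fun i => f i) ⟨i.1, heq⟩)
  refine (key L).mono fun w => le_gather fun i hi => ?_
  subst hi
  exact gather_le (dst := fun i : {i // (rank i : ℕ) < L} => dst i)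
    (f := fun i => f i) ⟨i, (rank i).2⟩

/-- Delivery along a fixed pattern in which every node has to send and to receive at most
`D * |N|` messages. -/
theorem delivers_static [Finite I] [Finite N] {src dst : I → N} {D : ℕ}
    (hs : ∀ v, {i | src i = v}.ncard ≤ D * Nat.card N)
    (hd : ∀ v, {i | dst i = v}.ncard ≤ D * Nat.card N) :
    Delivers Ω (⊤ : SimpleGraph N) B (4 * D) src dst := by
  obtain ⟨col, hcol⟩ := exists_relay_colouring src dst D hs hd
  -- Edges of equal colour differ at both ends, so for each number `(col i).1` no two messages share
  -- a hop from source to relay, or from relay to destination.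
  have h1 : Delivers Ω (⊤ : SimpleGraph N) B (2 * D) src (fun i => (col i).2) :=
    delivers_direct (fun i => (col i).1) fun i j hr hsrc hy => by
      by_contra hij
      exact (hcol i j hij (Prod.ext hr hy)).1 hsrc
  have h2 : Delivers Ω (⊤ : SimpleGraph N) B (2 * D) (fun i => (col i).2) dst :=
    delivers_direct (fun i => (col i).1) fun i j hr hy hdst => by
      by_contra hij
      exact (hcol i j hij (Prod.ext hr hy)).2 hdst
  exact (h1.trans h2).mono_time (by omega)

theorem delivers_clique :
    Delivers Ω (⊤ : SimpleGraph N) B 1 (Prod.fst : N × N → N) Prod.snd :=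
  delivers_one fun _ _ => Prod.ext

/-! ### Packets -/

open Classical in
/-- The values `val p ω` of the active packets `p` that are at the node `v`. -/
noncomputable def held (act : P → Ω → Prop) (loc : P → Ω → N) (val : P → Ω → X) (v : N) (ω : Ω)
    (p : P) : Option X :=
  if act p ω ∧ loc p ω = v then some (val p ω) else none

theorem held_eq_some {act : P → Ω → Prop} {loc : P → Ω → N} {val : P → Ω → X} {v : N} {ω : Ω}
    {p : P} {x : X} :
    held act loc val v ω p = some x ↔ act p ω ∧ loc p ω = v ∧ val p ω = x := by
  unfold held
  split_ifs with h
  · simp [h.1, h.2]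
  · simp only [false_iff]
    exact fun H => h ⟨H.1, H.2.1⟩

/-- A node that holds a packet in one of two indistinguishable situations does so in the other. -/
theorem held_transfer {act : P → Ω → Prop} {loc : P → Ω → N} {val : P → Ω → X} {v : N}
    {ω ω' : Ω} (h : held act loc val v ω = held act loc val v ω') {p : P} (ha : act p ω)
    (hl : loc p ω = v) : act p ω' ∧ loc p ω' = v ∧ val p ω' = val p ω :=
  held_eq_some.1 ((congrFun h p).symm.trans (held_eq_some.2 ⟨ha, hl, rfl⟩))

/-- To show that a node knows the values of the packets that it holds. -/
theorem le_ker_held {act : P → Ω → Prop} {loc : P → Ω → N} {val : P → Ω → X} {v : N}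
    {K : Setoid Ω}
    (h : ∀ ω ω', K ω ω' → ∀ p, act p ω → loc p ω = v →
      act p ω' ∧ loc p ω' = v ∧ val p ω' = val p ω) :
    K ≤ Setoid.ker (held act loc val v) := by
  intro ω ω' hω
  refine funext fun p => Option.ext fun x => ?_
  rw [held_eq_some, held_eq_some]
  constructor
  · rintro ⟨ha, hl, rfl⟩
    exact h ω ω' hω p ha hl
  · rintro ⟨ha, hl, rfl⟩
    exact h ω' ω (K.symm' hω) p ha hl

open Classical in
/-- Some element with the given property, if there is one. -/
noncomputable def pick {Z : Type*} (p : Z → Prop) : Option Z :=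
  if h : ∃ z, p z then some h.choose else none

theorem pick_eq_some {Z : Type*} {p : Z → Prop} (h : ∀ z z', p z → p z' → z = z') {z : Z} :
    pick p = some z ↔ p z := by
  unfold pick
  split_ifs with hz
  · rw [Option.some_inj]
    exact ⟨fun e => e ▸ hz.choose_spec, fun hp => h _ _ hz.choose_spec hp⟩
  · simp only [false_iff]
    exact fun hp => hz ⟨z, hp⟩

/-- If the packets at a node have different colours both before and after the move, then they can
be moved in a clique by way of the relay nodes given by the colours. -/
theorem learn_relay [Finite P] [Finite X] [Finite N] {c L : ℕ}
    (hc : Nat.card (Option (P × X × N)) ≤ 2 ^ (B * c)) {K : N → Setoid Ω}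
    {act : P → Ω → Prop} {loc loc' : P → Ω → N} {col : P → Ω → Fin L × N} {val : P → Ω → X}
    (hK : ∀ v, K v ≤ Setoid.ker (held act loc (fun p ω => (val p ω, loc' p ω, col p ω)) v))
    (hsrc : ∀ ω p p', act p ω → act p' ω → col p ω = col p' ω → loc p ω = loc p' ω → p = p')
    (hdst : ∀ ω p p', act p ω → act p' ω → col p ω = col p' ω → loc' p ω = loc' p' ω → p = p') :
    Learn (⊤ : SimpleGraph N) B (2 * (c * L)) K
      (fun w => Setoid.ker (held act loc' val w)) := by
  classical
  have hcard : Nat.card (Fin L → Option (P × X × N)) ≤ 2 ^ (B * (c * L)) := by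
    rw [Nat.card_fun, Nat.card_fin, ← mul_assoc, pow_mul]
    exact Nat.pow_le_pow_left hc L
  -- What `v` sends to the relay `y`: in position `l` the packet of colour `(l, y)`, unique by
  -- `hsrc`.
  let F : N → N → Ω → Fin L → Option (P × X × N) := fun v y ω l =>
    pick fun z => held act loc (fun p ω => (val p ω, loc' p ω, col p ω)) v ω z.1 =
      some (z.2.1, z.2.2, (l, y))
  have hF : ∀ v y ω l p x d, F v y ω l = some (p, x, d) ↔
      act p ω ∧ loc p ω = v ∧ val p ω = x ∧ loc' p ω = d ∧ col p ω = (l, y) := by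
    intro v y ω l p x d
    simp only [F]
    rw [pick_eq_some]
    · simp only [held_eq_some, Prod.mk.injEq]
    · rintro ⟨p, x, d⟩ ⟨p', x', d'⟩ h h'
      simp only [held_eq_some, Prod.mk.injEq] at h h'
      obtain ⟨ha, hl, rfl, rfl, hcol⟩ := h
      obtain ⟨ha', hl', rfl, rfl, hcol'⟩ := h'
      obtain rfl := hsrc ω p p' ha ha' (hcol.trans hcol'.symm) (hl.trans hl'.symm)
      rfl
  -- What the relay `y` passes on to `w`, computed from the arrays `F v y` alone; uniqueness is
  -- `hdst`.
  let H : N → N → Ω → Fin L → Option (P × X × N) := fun y w ω l =>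
    pick fun z => ∃ v, F v y ω l = some z ∧ z.2.2 = w
  have hH : ∀ y w ω l p x d, H y w ω l = some (p, x, d) ↔
      act p ω ∧ val p ω = x ∧ loc' p ω = d ∧ col p ω = (l, y) ∧ d = w := by
    intro y w ω l p x d
    simp only [H]
    rw [pick_eq_some]
    · simp only [hF]
      constructor
      · rintro ⟨v, ⟨ha, -, hx, hd, hcol⟩, rfl⟩
        exact ⟨ha, hx, hd, hcol, rfl⟩
      · rintro ⟨ha, hx, hd, hcol, rfl⟩
        exact ⟨loc p ω, ⟨ha, rfl, hx, hd, hcol⟩, rfl⟩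
    · rintro ⟨p, x, d⟩ ⟨p', x', d'⟩ ⟨v, h, hw⟩ ⟨v', h', hw'⟩
      obtain ⟨ha, -, rfl, rfl, hcol⟩ := (hF _ _ _ _ _ _ _).1 h
      obtain ⟨ha', -, rfl, rfl, hcol'⟩ := (hF _ _ _ _ _ _ _).1 h'
      obtain rfl := hdst ω p p' ha ha' (hcol.trans hcol'.symm) (hw.trans hw'.symm)
      rfl
  have step1 := delivers_clique.large hcard K (fun i => F i.1 i.2) fun i x y hxy =>
    funext fun l => by
      have h : held act loc (fun p ω => (val p ω, loc' p ω, col p ω)) i.1 x =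
        held act loc (fun p ω => (val p ω, loc' p ω, col p ω)) i.1 y := hK i.1 hxy
      simp only [F, h]
  have step2 := delivers_clique.large hcard (gather Prod.snd fun i : N × N => F i.1 i.2)
    (fun i => H i.1 i.2) fun i x y hxy => funext fun l => by
      have h : ∀ v, F v i.1 x = F v i.1 y := fun v =>
        gather_le (dst := Prod.snd) (f := fun i : N × N => F i.1 i.2) (v, i.1) hxy
      simp only [H, h]
  rw [two_mul]
  refine ((step1.trans step2).mono fun w => ?_).mono_time (by simp)
  refine le_ker_held fun ω ω' hω p ha hl => ?_
  have h := congrFun (gather_le (dst := Prod.snd) (f := fun i : N × N => H i.1 i.2)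
    ((col p ω).2, w) hω) (col p ω).1
  rw [show H ((col p ω).2, w).1 ((col p ω).2, w).2 ω (col p ω).1 = some (p, val p ω, w) from
    (hH _ _ _ _ _ _ _).2 ⟨ha, rfl, hl, rfl, rfl⟩] at h
  obtain ⟨ha', hv', hl', -, -⟩ := (hH _ _ _ _ _ _ _).1 h.symm
  exact ⟨ha', hl', hv'⟩

end CorePeriphery

/-! ### Routing in a square grid of nodes that form a clique -/

namespace CorePeriphery

variable {N Ω X P : Type*} {B : ℕ}

/-! ### Enumerating and counting packets. -/

open Classical in
/-- The position of `p` in an enumeration of `S`. -/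
noncomputable def rank [Finite P] (S : Set P) (p : P) : ℕ :=
  if h : p ∈ S then Finite.equivFin S ⟨p, h⟩ else 0

theorem rank_lt [Finite P] {S : Set P} {p : P} (h : p ∈ S) : rank S p < S.ncard := by
  rw [rank, dif_pos h, ← Nat.card_coe_set_eq]
  exact Fin.is_lt _

theorem rank_inj [Finite P] {S : Set P} {p q : P} (hp : p ∈ S) (hq : q ∈ S)
    (h : rank S p = rank S q) : p = q := by
  rw [rank, rank, dif_pos hp, dif_pos hq] at h
  exact congrArg Subtype.val ((Finite.equivFin S).injective (Fin.ext h))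

/-- The elements of `S` are dealt in turn to `r` receivers; those of one receiver are told apart by
the quotients of their ranks. As `rank` depends on the set only, whoever knows `S` can deal. -/
theorem ncard_rank_mod_le [Finite P] (S : Set P) (r j : ℕ) :
    {p | p ∈ S ∧ rank S p % r = j}.ncard ≤ S.ncard / r + 1 := by
  rw [← Finset.card_range (S.ncard / r + 1), ← Set.ncard_coe_finset]
  refine Set.ncard_le_ncard_of_injOn (fun p => rank S p / r) ?_ ?_ (Set.toFinite _)
  · rintro p ⟨hp, -⟩
    exact Finset.mem_coe.2 (Finset.mem_range.2
      (Nat.lt_succ_of_le (Nat.div_le_div_right (rank_lt hp).le)))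
  · rintro p ⟨hp, hpj⟩ q ⟨hq, hqj⟩ h
    refine rank_inj hp hq ?_
    rw [← Nat.div_add_mod (rank S p) r, ← Nat.div_add_mod (rank S q) r, hpj, hqj]
    exact congrArg (fun x => r * x + j) h

theorem ncard_eq_sum_fibres [Finite P] {ι : Type*} [Fintype ι] (A : P → Prop) (c : P → ι) :
    {p | A p}.ncard = ∑ i, {p | A p ∧ c p = i}.ncard := by
  classical
  have := Fintype.ofFinite P
  have h : ∀ A : P → Prop, {p | A p}.ncard = (Finset.univ.filter A).card := fun A => by
    rw [← Set.ncard_coe_finset, Finset.coe_filter_univ]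
  simp only [h]
  rw [Finset.card_eq_sum_card_fiberwise (f := c) (t := Finset.univ) (fun _ _ => Finset.mem_univ _)]
  simp only [Finset.filter_filter]
  refine Finset.sum_congr rfl fun i _ => ?_
  congr

theorem sum_div_le {ι : Type*} (s : Finset ι) (f : ι → ℕ) {r : ℕ} (hr : 0 < r) :
    ∑ i ∈ s, f i / r ≤ (∑ i ∈ s, f i) / r := by
  rw [Nat.le_div_iff_mul_le hr, Finset.sum_mul]
  exact Finset.sum_le_sum fun i _ => Nat.div_mul_le_self _ _

section Grid

variable [Finite P] [Finite X] {r D c c' : ℕ}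

/-- A colouring of the edges of a bipartite multigraph that depends only on the multiplicities. -/
theorem exists_matrix_colouring (e : N ≃ Fin r × Fin r) (hD : 0 < D) (hr : 0 < r)
    (M : Fin r → Fin r → ℕ) :
    ∃ χ : Fin r → Fin r → ℕ → Fin (2 * D) × N,
      (∀ x, ∑ i, M x i ≤ D * (r * r)) → (∀ i, ∑ x, M x i ≤ D * (r * r)) →
      ∀ x i l x' i' l', l < M x i → l' < M x' i' → χ x i l = χ x' i' l' →
        x = x' ∨ i = i' → x = x' ∧ i = i' ∧ l = l' := by
  classical
  have : Finite N := Finite.of_equiv _ e.symm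
  have hN : Nat.card N = r * r := by simp [Nat.card_congr e]
  -- A junk colour. The bounds on `M` are premises of the conclusion, so that `χ` can be chosen as a
  -- function of `M` alone.
  let d : Fin (2 * D) × N := (⟨0, by omega⟩, e.symm (⟨0, hr⟩, ⟨0, hr⟩))
  by_cases hrow : ∀ x, ∑ i, M x i ≤ D * (r * r)
  swap
  · exact ⟨fun _ _ _ => d, fun h => absurd h hrow⟩
  by_cases hcol : ∀ i, ∑ x, M x i ≤ D * (r * r)
  swap
  · exact ⟨fun _ _ _ => d, fun _ h => absurd h hcol⟩
  let E : Type := (x : Fin r) × (i : Fin r) × Fin (M x i)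
  have hE : ∀ x i, {t : E | t.1 = x ∧ t.2.1 = i}.ncard ≤ M x i := by
    intro x i
    rw [← Finset.card_range (M x i), ← Set.ncard_coe_finset]
    refine Set.ncard_le_ncard_of_injOn (fun t => (t.2.2 : ℕ)) ?_ ?_ (Set.toFinite _)
    · rintro ⟨x', i', l⟩ ⟨rfl, rfl⟩
      exact Finset.mem_coe.2 (Finset.mem_range.2 l.2)
    · rintro ⟨x', i', l⟩ ⟨rfl, rfl⟩ ⟨x'', i'', l'⟩ ⟨h1, h2⟩ h
      obtain rfl : x'' = x' := h1
      obtain rfl : i'' = i' := h2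
      obtain rfl : l = l' := Fin.ext h
      rfl
  obtain ⟨col, hc⟩ := exists_relay_colouring (N := N) (fun t : E => t.1) (fun t : E => t.2.1) D
    (fun x => by
      rw [hN, ncard_eq_sum_fibres (fun t : E => t.1 = x) (fun t => t.2.1)]
      exact (Finset.sum_le_sum fun i _ => hE x i).trans (hrow x))
    (fun i => by
      rw [hN, ncard_eq_sum_fibres (fun t : E => t.2.1 = i) (fun t => t.1)]
      simp only [and_comm]
      exact (Finset.sum_le_sum fun x _ => hE x i).trans (hcol i))
  refine ⟨fun x i l => if h : l < M x i then col ⟨x, i, l, h⟩ else d,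
    fun _ _ x i l x' i' l' hl hl' h hor => ?_⟩
  simp only [dif_pos hl, dif_pos hl'] at h
  by_contra hne
  obtain ⟨h1, h2⟩ := hc ⟨x, i, l, hl⟩ ⟨x', i', l', hl'⟩ (fun heq => hne (by
    have h1 : x = x' := congrArg Sigma.fst heq
    subst h1
    have h2 : i = i' := congrArg (fun t : E => t.2.1) heq
    subst h2
    have h3 : l = l' := congrArg (fun t : E => (t.2.2 : ℕ)) heq
    exact ⟨rfl, rfl, h3⟩)) h
  exact hor.elim h1 h2

/-- The nodes of a row tell each other numbers, one for each of them and each column. -/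
theorem delivers_announce (e : N ≃ Fin r × Fin r) :
    Delivers Ω (⊤ : SimpleGraph N) B 4
      (fun t : Fin r × Fin r × Fin r × Fin r => e.symm (t.1, t.2.1))
      (fun t => e.symm (t.1, t.2.2.2)) := by
  have : Finite N := Finite.of_equiv _ e.symm
  have hN : Nat.card N = r * r := by simp [Nat.card_congr e]
  have hrr : (Set.univ : Set (Fin r × Fin r)).ncard = r * r := by simp [Set.ncard_univ]
  -- The index `(g, x, i, j)` stands for the count of class `i` at node `(g, x)`, told to node `(g,
  -- j)`: `r * r` messages out of and into every node.
  refine delivers_static (D := 1) (fun v => ?_) fun v => ?_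
  · rw [one_mul, hN, ← hrr]
    refine Set.ncard_le_ncard_of_injOn (fun t => (t.2.2.1, t.2.2.2)) (fun _ _ => trivial) ?_
      (Set.toFinite _)
    rintro ⟨g, x, i, j⟩ h ⟨g', x', i', j'⟩ h' heq
    have := e.symm.injective (Eq.trans h (Eq.symm h'))
    simp only [Prod.mk.injEq] at heq this ⊢
    exact ⟨this.1, this.2, heq.1, heq.2⟩
  · rw [one_mul, hN, ← hrr]
    refine Set.ncard_le_ncard_of_injOn (fun t => (t.2.1, t.2.2.1)) (fun _ _ => trivial) ?_
      (Set.toFinite _)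
    rintro ⟨g, x, i, j⟩ h ⟨g', x', i', j'⟩ h' heq
    have := e.symm.injective (Eq.trans h (Eq.symm h'))
    simp only [Prod.mk.injEq] at heq this ⊢
    exact ⟨this.1, heq.1, heq.2, this.2⟩

/-- Routing within the rows: the nodes of a row tell each other how many packets they have for each
of them, and then all of them compute the same colouring. -/
theorem learn_inGroup (e : N ≃ Fin r × Fin r) (hD : 0 < D) (hr : 0 < r)
    (hc : Nat.card (Option (P × X × N)) ≤ 2 ^ (B * c)) (hc' : D * (r * r) + 1 ≤ 2 ^ (B * c'))
    {K : N → Setoid Ω} {act : P → Ω → Prop} {loc : P → Ω → N} {val : P → Ω → X}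
    (cls : P → Ω → Fin r)
    (hK : ∀ v, K v ≤ Setoid.ker (held act loc (fun p ω => (val p ω, cls p ω)) v))
    (hs : ∀ ω v, {p | act p ω ∧ loc p ω = v}.ncard ≤ D * (r * r))
    (hd : ∀ ω g i, {p | act p ω ∧ (e (loc p ω)).1 = g ∧ cls p ω = i}.ncard ≤ D * (r * r)) :
    Learn (⊤ : SimpleGraph N) B (c' * 4 + 2 * (c * (2 * D))) K (fun w => Setoid.ker
      (held act (fun p ω => e.symm ((e (loc p ω)).1, cls p ω)) val w)) := by
  classical
  have : Finite N := Finite.of_equiv _ e.symm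
  let S : N → Fin r → Ω → Set P := fun v i ω => {p | act p ω ∧ loc p ω = v ∧ cls p ω = i}
  have hS : ∀ v i ω, (S v i ω).ncard ≤ D * (r * r) := fun v i ω =>
    (Set.ncard_le_ncard (s := S v i ω) (t := {p | act p ω ∧ loc p ω = v})
      (fun p hp => ⟨hp.1, hp.2.1⟩) (Set.toFinite _)).trans (hs ω v)
  have hSK : ∀ v i ω ω', K v ω ω' → S v i ω = S v i ω' := by
    intro v i ω ω' h
    refine Set.ext fun p => ⟨fun hp => ?_, fun hp => ?_⟩
    · obtain ⟨h1, h2, h3⟩ := held_transfer (hK v h) hp.1 hp.2.1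
      exact ⟨h1, h2, (congrArg Prod.snd h3).trans hp.2.2⟩
    · obtain ⟨h1, h2, h3⟩ := held_transfer (hK v h).symm hp.1 hp.2.1
      exact ⟨h1, h2, (congrArg Prod.snd h3).trans hp.2.2⟩
  let M : Fin r → Ω → Fin r → Fin r → ℕ := fun g ω x i => (S (e.symm (g, x)) i ω).ncard
  have hrow : ∀ g ω x, ∑ i, M g ω x i ≤ D * (r * r) := by
    intro g ω x
    refine le_trans (le_of_eq ?_) (hs ω (e.symm (g, x)))
    rw [ncard_eq_sum_fibres (fun p => act p ω ∧ loc p ω = e.symm (g, x)) (fun p => cls p ω)]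
    simp only [M, S, and_assoc]
  have hcol : ∀ g ω i, ∑ x, M g ω x i ≤ D * (r * r) := by
    intro g ω i
    refine le_trans (le_of_eq ?_) (hd ω g i)
    rw [ncard_eq_sum_fibres _ (fun p => (e (loc p ω)).2)]
    refine Finset.sum_congr rfl fun x _ => congrArg Set.ncard (Set.ext fun p => ?_)
    change (act p ω ∧ loc p ω = e.symm (g, x) ∧ cls p ω = i) ↔
      ((act p ω ∧ (e (loc p ω)).1 = g ∧ cls p ω = i) ∧ (e (loc p ω)).2 = x)
    rw [Equiv.eq_symm_apply, Prod.ext_iff]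
    tauto
  choose χ hχ using exists_matrix_colouring e hD hr
  let col : P → Ω → Fin (2 * D) × N := fun p ω =>
    χ (M (e (loc p ω)).1 ω) (e (loc p ω)).2 (cls p ω) (rank (S (loc p ω) (cls p ω) ω) p)
  -- Clashes need to be excluded only within a row: different rows have disjoint sources and
  -- destinations, so each of them may use all nodes of the grid as relays.
  have hcolour : ∀ ω p p', act p ω → act p' ω → col p ω = col p' ω →
      (e (loc p ω)).1 = (e (loc p' ω)).1 →
      ((e (loc p ω)).2 = (e (loc p' ω)).2 ∨ cls p ω = cls p' ω) → p = p' := by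
    intro ω p p' ha ha' h hg hor
    have hlt : ∀ p, act p ω → rank (S (loc p ω) (cls p ω) ω) p <
        M (e (loc p ω)).1 ω (e (loc p ω)).2 (cls p ω) := by
      intro p ha
      have : e.symm ((e (loc p ω)).1, (e (loc p ω)).2) = loc p ω := e.symm_apply_apply _
      simp only [M]
      rw [this]
      exact rank_lt (show p ∈ S (loc p ω) (cls p ω) ω from ⟨ha, rfl, rfl⟩)
    simp only [col] at h
    obtain ⟨h1, h2, h3⟩ := hχ _ (hrow _ ω) (hcol _ ω) _ _ _ _ _ _ (hlt p ha)
      (hg ▸ hlt p' ha') (h.trans (by rw [hg])) hor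
    have hl : loc p ω = loc p' ω := e.injective (Prod.ext hg h1)
    rw [hl, h2] at h3
    exact rank_inj (S := S (loc p' ω) (cls p' ω) ω) ⟨ha, hl, h2⟩ ⟨ha', rfl, rfl⟩ h3
  have ann := (delivers_announce (Ω := Ω) (B := B) e).large (X := Fin (D * (r * r) + 1)) (c := c')
    (by simpa using hc') K
    (fun t ω => ⟨(S (e.symm (t.1, t.2.1)) t.2.2.1 ω).ncard, Nat.lt_succ_of_le (hS _ _ _)⟩)
    (fun t x y hxy => Fin.ext (congrArg Set.ncard (hSK _ _ _ _ hxy)))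
  refine ann.keep.trans (learn_relay hc (loc := loc) (col := col) (fun v => ?_) ?_ ?_)
  · refine le_ker_held fun ω ω' hω p ha hl => ?_
    obtain ⟨h1, h2, h3⟩ := held_transfer (hK v hω.1) ha hl
    refine ⟨h1, h2, ?_⟩
    obtain ⟨hv, hcl⟩ := Prod.ext_iff.1 h3
    have hM : M (e v).1 ω' = M (e v).1 ω := by
      funext x i
      have h := gather_le (dst := fun t : Fin r × Fin r × Fin r × Fin r => e.symm (t.1, t.2.2.2))
        (f := fun t ω => (⟨(S (e.symm (t.1, t.2.1)) t.2.2.1 ω).ncard,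
          Nat.lt_succ_of_le (hS _ _ _)⟩ : Fin (D * (r * r) + 1))) ((e v).1, x, i, (e v).2)
      have hev : e.symm ((e v).1, (e v).2) = v := e.symm_apply_apply _
      simp only [hev] at h
      exact (congrArg Fin.val (h hω.2)).symm
    simp only at hv hcl
    simp only [col, hv, hcl, h2, hl, hM, hSK v (cls p ω) ω ω' hω.1]
  · intro ω p p' ha ha' h hl
    exact hcolour ω p p' ha ha' h (by rw [hl]) (Or.inl (by rw [hl]))
  · intro ω p p' ha ha' h hl
    have := e.symm.injective hl
    simp only [Prod.mk.injEq] at this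
    exact hcolour ω p p' ha ha' h this.1 (Or.inr this.2)

/-- The nodes of a row distribute their packets of each class evenly among them. -/
theorem learn_spread (e : N ≃ Fin r × Fin r) (hr : 0 < r)
    (hc : Nat.card (Option (P × X × N)) ≤ 2 ^ (B * c))
    {K : N → Setoid Ω} {act : P → Ω → Prop} {loc : P → Ω → N} {val : P → Ω → X}
    (cls : P → Ω → Fin r)
    (hK : ∀ v, K v ≤ Setoid.ker (held act loc (fun p ω => (val p ω, cls p ω)) v))
    (hs : ∀ ω v, {p | act p ω ∧ loc p ω = v}.ncard ≤ D * (r * r)) :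
    ∃ mem : P → Ω → Fin r,
      Learn (⊤ : SimpleGraph N) B (2 * (c * (2 * (D + 1)))) K (fun w => Setoid.ker
        (held act (fun p ω => e.symm ((e (loc p ω)).1, mem p ω)) val w)) ∧
      ∀ ω v i j, {p | (act p ω ∧ loc p ω = v ∧ cls p ω = i) ∧ mem p ω = j}.ncard ≤
        {p | act p ω ∧ loc p ω = v ∧ cls p ω = i}.ncard / r + 1 := by
  classical
  have : Finite N := Finite.of_equiv _ e.symm
  have hN : Nat.card N = r * r := by simp [Nat.card_congr e]
  let S : N → Fin r → Ω → Set P := fun v i ω => {p | act p ω ∧ loc p ω = v ∧ cls p ω = i}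
  let mem : P → Ω → Fin r := fun p ω =>
    ⟨rank (S (loc p ω) (cls p ω) ω) p % r, Nat.mod_lt _ hr⟩
  have hmem : ∀ ω v i j, {p | (act p ω ∧ loc p ω = v ∧ cls p ω = i) ∧ mem p ω = j}.ncard ≤
      {p | act p ω ∧ loc p ω = v ∧ cls p ω = i}.ncard / r + 1 := by
    intro ω v i j
    refine (Set.ncard_le_ncard ?_ (Set.toFinite _)).trans (ncard_rank_mod_le (S v i ω) r j)
    rintro p ⟨⟨ha, rfl, rfl⟩, hj⟩
    exact ⟨⟨ha, rfl, rfl⟩, congrArg Fin.val hj⟩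
  refine ⟨mem, ?_, hmem⟩
  let S' : N → Fin r → Ω → Set P := fun v j ω => {p | (act p ω ∧ loc p ω = v) ∧ mem p ω = j}
  have hS' : ∀ v j ω, (S' v j ω).ncard ≤ (D + 1) * r := by
    intro v j ω
    simp only [S']
    rw [ncard_eq_sum_fibres _ (fun p => cls p ω)]
    calc ∑ i, {p | ((act p ω ∧ loc p ω = v) ∧ mem p ω = j) ∧ cls p ω = i}.ncard
        = ∑ i, {p | (act p ω ∧ loc p ω = v ∧ cls p ω = i) ∧ mem p ω = j}.ncard := by
          refine Finset.sum_congr rfl fun i _ => congrArg Set.ncard (Set.ext fun p => ?_)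
          change (_ ∧ _) ↔ (_ ∧ _)
          tauto
      _ ≤ ∑ i : Fin r, ({p | (act p ω ∧ loc p ω = v) ∧ cls p ω = i}.ncard / r + 1) :=
          Finset.sum_le_sum fun i _ => by simpa only [and_assoc] using hmem ω v i j
      _ ≤ {p | act p ω ∧ loc p ω = v}.ncard / r + r := by
          rw [Finset.sum_add_distrib, ncard_eq_sum_fibres (fun p => act p ω ∧ loc p ω = v)
            (fun p => cls p ω)]
          exact add_le_add (sum_div_le _ _ hr) (by simp)
      _ ≤ D * (r * r) / r + r := Nat.add_le_add_right (Nat.div_le_div_right (hs ω v)) _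
      _ = (D + 1) * r := by rw [← mul_assoc, Nat.mul_div_cancel _ hr, Nat.succ_mul]
  have hpos : 0 < (D + 1) * r := by positivity
  have hcard : (Set.univ : Set (Fin r × Fin ((D + 1) * r))).ncard = (D + 1) * Nat.card N := by
    rw [Set.ncard_univ, hN]
    simp
    ring
  -- By `hS'` a node has at most `(D + 1) * r` packets for each member of its row. A colouring of
  -- the uniform multigraph with this multiplicity can be fixed in advance, so no counts need to be
  -- announced.
  obtain ⟨χ, hχ⟩ := exists_relay_colouring (N := N)
    (fun t : N × Fin r × Fin ((D + 1) * r) => t.1)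
    (fun t : N × Fin r × Fin ((D + 1) * r) => e.symm ((e t.1).1, t.2.1)) (D + 1)
    (fun v => by
      rw [← hcard]
      refine Set.ncard_le_ncard_of_injOn (fun t => t.2) (fun _ _ => trivial) ?_ (Set.toFinite _)
      rintro ⟨v, j, l⟩ h ⟨v', j', l'⟩ h' heq
      exact Prod.ext (Eq.trans h (Eq.symm h')) heq)
    (fun v => by
      rw [← hcard]
      refine Set.ncard_le_ncard_of_injOn (fun t => ((e t.1).2, t.2.2)) (fun _ _ => trivial) ?_
        (Set.toFinite _)
      rintro ⟨v, j, l⟩ h ⟨v', j', l'⟩ h' heq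
      have := e.symm.injective (Eq.trans h (Eq.symm h'))
      simp only [Prod.mk.injEq] at this heq ⊢
      exact ⟨e.injective (Prod.ext this.1 heq.1), this.2, heq.2⟩)
  -- The remainder only serves to land in `Fin`; for active packets the rank is already smaller.
  let col : P → Ω → Fin (2 * (D + 1)) × N := fun p ω =>
    χ (loc p ω, mem p ω, ⟨rank (S' (loc p ω) (mem p ω) ω) p % ((D + 1) * r), Nat.mod_lt _ hpos⟩)
  have hcolour : ∀ ω p p', act p ω → act p' ω → col p ω = col p' ω →
      (loc p ω = loc p' ω ∨ e.symm ((e (loc p ω)).1, mem p ω) =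
        e.symm ((e (loc p' ω)).1, mem p' ω)) → p = p' := by
    intro ω p p' ha ha' h hor
    by_contra hne
    obtain ⟨h1, h2⟩ := hχ _ _ (fun heq => hne (by
      simp only [Prod.mk.injEq, Fin.mk.injEq] at heq
      obtain ⟨hl, hm, hrk⟩ := heq
      have hp : p ∈ S' (loc p' ω) (mem p' ω) ω := ⟨⟨ha, hl⟩, hm⟩
      have hp' : p' ∈ S' (loc p' ω) (mem p' ω) ω := ⟨⟨ha', rfl⟩, rfl⟩
      rw [hl, hm, Nat.mod_eq_of_lt (lt_of_lt_of_le (rank_lt hp) (hS' _ _ _)),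
        Nat.mod_eq_of_lt (lt_of_lt_of_le (rank_lt hp') (hS' _ _ _))] at hrk
      exact rank_inj hp hp' hrk)) h
    exact hor.elim h1 h2
  refine learn_relay hc (loc := loc) (col := col) (fun v => ?_)
    (fun ω p p' ha ha' h hl => hcolour ω p p' ha ha' h (Or.inl hl))
    (fun ω p p' ha ha' h hl => hcolour ω p p' ha ha' h (Or.inr hl))
  have hKS : ∀ ω ω', K v ω ω' → ∀ i, S v i ω ⊆ S v i ω' := by
    intro ω ω' h i p hp
    obtain ⟨h1, h2, h3⟩ := held_transfer (hK v h) hp.1 hp.2.1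
    exact ⟨h1, h2, (congrArg Prod.snd h3).trans hp.2.2⟩
  have hKS' : ∀ ω ω', K v ω ω' → ∀ i, S v i ω = S v i ω' := fun ω ω' h i =>
    (hKS ω ω' h i).antisymm (hKS ω' ω ((K v).symm' h) i)
  have hKm : ∀ ω ω', K v ω ω' → ∀ p, act p ω → loc p ω = v → mem p ω' = mem p ω := by
    intro ω ω' h p ha hl
    obtain ⟨h1, h2, h3⟩ := held_transfer (hK v h) ha hl
    have hcl : cls p ω' = cls p ω := congrArg Prod.snd h3
    refine Fin.ext ?_
    simp only [mem, h2, hl, hcl, hKS' ω ω' h]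
  have hKT : ∀ ω ω', K v ω ω' → ∀ j, S' v j ω ⊆ S' v j ω' := by
    intro ω ω' h j p hp
    obtain ⟨h1, h2, -⟩ := held_transfer (hK v h) hp.1.1 hp.1.2
    exact ⟨⟨h1, h2⟩, (hKm ω ω' h p hp.1.1 hp.1.2).trans hp.2⟩
  refine le_ker_held fun ω ω' hω p ha hl => ?_
  obtain ⟨h1, h2, h3⟩ := held_transfer (hK v hω) ha hl
  have hv : val p ω' = val p ω := congrArg Prod.fst h3
  have hm := hKm ω ω' hω p ha hl
  have hT : S' v (mem p ω) ω' = S' v (mem p ω) ω :=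
    (hKT ω' ω ((K v).symm' hω) _).antisymm (hKT ω ω' hω _)
  refine ⟨h1, h2, ?_⟩
  simp only [col, h2, hl, hm, hv, hT]

/-- The number of rounds for routing in the grid: every node sends and receives at most `D * r ^ 2`
packets, and `c` and `c'` are the numbers of messages for a packet and for a count. -/
def routeTime (D c c' : ℕ) : ℕ :=
  2 * (c * (2 * (D + 1))) + 2 * (c' * 4 + 2 * (c * (2 * (D + 1))))

/-- Three moves: spreading inside the row of the source, then inside a column to the row of the
destination, then inside that row. Spreading by destination row is what makes the other two moves
balanced; the price is `D + 1` in place of `D`. -/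
theorem learn_route (e : N ≃ Fin r × Fin r) (hr : 0 < r)
    (hc : Nat.card (Option (P × (X × N) × N)) ≤ 2 ^ (B * c))
    (hc' : (D + 1) * (r * r) + 1 ≤ 2 ^ (B * c'))
    {K : N → Setoid Ω} {act : P → Ω → Prop} {loc dst : P → Ω → N} {val : P → Ω → X}
    (hK : ∀ v, K v ≤ Setoid.ker (held act loc (fun p ω => (val p ω, dst p ω)) v))
    (hs : ∀ ω v, {p | act p ω ∧ loc p ω = v}.ncard ≤ D * (r * r))
    (hd : ∀ ω v, {p | act p ω ∧ dst p ω = v}.ncard ≤ D * (r * r)) :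
    Learn (⊤ : SimpleGraph N) B (routeTime D c c') K
      (fun w => Setoid.ker (held act dst val w)) := by
  have : Finite N := Finite.of_equiv _ e.symm
  obtain ⟨mem, h1, hmem⟩ := learn_spread (D := D) (X := X × N) e hr hc
    (val := fun p ω => (val p ω, dst p ω)) (fun p ω => (e (dst p ω)).1)
    (fun v => le_ker_held fun ω ω' hω p ha hl => by
      obtain ⟨h1, h2, h3⟩ := held_transfer (hK v hω) ha hl
      have h4 : dst p ω' = dst p ω := congrArg Prod.snd h3
      exact ⟨h1, h2, Prod.ext h3 (by rw [h4])⟩) hs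
  have hmem' : ∀ ω v j, {p | (act p ω ∧ loc p ω = v) ∧ mem p ω = j}.ncard ≤ (D + 1) * r := by
    intro ω v j
    rw [ncard_eq_sum_fibres _ (fun p => (e (dst p ω)).1)]
    calc ∑ i, {p | ((act p ω ∧ loc p ω = v) ∧ mem p ω = j) ∧ (e (dst p ω)).1 = i}.ncard
        = ∑ i, {p | (act p ω ∧ loc p ω = v ∧ (e (dst p ω)).1 = i) ∧ mem p ω = j}.ncard := by
          refine Finset.sum_congr rfl fun i _ => congrArg Set.ncard (Set.ext fun p => ?_)
          change (_ ∧ _) ↔ (_ ∧ _)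
          tauto
      _ ≤ ∑ i : Fin r, ({p | (act p ω ∧ loc p ω = v) ∧ (e (dst p ω)).1 = i}.ncard / r + 1) :=
          Finset.sum_le_sum fun i _ => by simpa only [and_assoc] using hmem ω v i j
      _ ≤ {p | act p ω ∧ loc p ω = v}.ncard / r + r := by
          rw [Finset.sum_add_distrib, ncard_eq_sum_fibres (fun p => act p ω ∧ loc p ω = v)
            (fun p => (e (dst p ω)).1)]
          exact add_le_add (sum_div_le _ _ hr) (by simp)
      _ ≤ D * (r * r) / r + r := Nat.add_le_add_right (Nat.div_le_div_right (hs ω v)) _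
      _ = (D + 1) * r := by rw [← mul_assoc, Nat.mul_div_cancel _ hr, Nat.succ_mul]
  let loc₁ : P → Ω → N := fun p ω => e.symm ((e (loc p ω)).1, mem p ω)
  let loc₂ : P → Ω → N := fun p ω => e.symm ((e (dst p ω)).1, mem p ω)
  have hs₁ : ∀ ω v, {p | act p ω ∧ loc₁ p ω = v}.ncard ≤ (D + 1) * (r * r) := by
    intro ω v
    rw [ncard_eq_sum_fibres _ (fun p => (e (loc p ω)).2)]
    refine (Finset.sum_le_card_nsmul _ _ ((D + 1) * r) fun x _ => ?_).trans
      (by simp [mul_left_comm])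
    refine (Set.ncard_le_ncard ?_ (Set.toFinite _)).trans
      (hmem' ω (e.symm ((e v).1, x)) (e v).2)
    rintro p ⟨⟨ha, rfl⟩, rfl⟩
    refine ⟨⟨ha, ?_⟩, ?_⟩ <;> simp [loc₁]
  have hs₂ : ∀ ω v, {p | act p ω ∧ loc₂ p ω = v}.ncard ≤ (D + 1) * (r * r) := by
    intro ω v
    have hfin := Fintype.ofFinite N
    have hN : Fintype.card N = r * r := by simp [Fintype.card_congr e]
    rw [ncard_eq_sum_fibres _ (fun p => loc p ω)]
    -- Of its packets for the row of `v`, each of the `r * r` nodes `q` deals a share of `1 / r`, up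
    -- to one packet, to the column of `v`; that row receives at most `r * (D * (r * r))` packets in
    -- total.
    calc ∑ q, {p | (act p ω ∧ loc₂ p ω = v) ∧ loc p ω = q}.ncard
        ≤ ∑ q, ({p | (act p ω ∧ (e (dst p ω)).1 = (e v).1) ∧ loc p ω = q}.ncard / r + 1) := by
          refine Finset.sum_le_sum fun q _ => ?_
          refine (Set.ncard_le_ncard ?_ (Set.toFinite _)).trans
            ((hmem ω q (e v).1 (e v).2).trans (le_of_eq ?_))
          · rintro p ⟨⟨ha, rfl⟩, rfl⟩
            simp [loc₂, ha]
          · congr 3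
            refine Set.ext fun p => ?_
            change (_ ∧ _) ↔ (_ ∧ _)
            tauto
      _ ≤ {p | act p ω ∧ (e (dst p ω)).1 = (e v).1}.ncard / r + r * r := by
          rw [Finset.sum_add_distrib, ncard_eq_sum_fibres (fun p => act p ω ∧
            (e (dst p ω)).1 = (e v).1) (fun p => loc p ω)]
          exact add_le_add (sum_div_le _ _ hr) (by simp [hN])
      _ ≤ r * (D * (r * r)) / r + r * r := by
          refine Nat.add_le_add_right (Nat.div_le_div_right ?_) _
          rw [ncard_eq_sum_fibres _ (fun p => (e (dst p ω)).2)]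
          refine (Finset.sum_le_card_nsmul _ _ (D * (r * r)) fun x _ => ?_).trans (by simp)
          refine (Set.ncard_le_ncard ?_ (Set.toFinite _)).trans (hd ω (e.symm ((e v).1, x)))
          rintro p ⟨⟨ha, hp⟩, rfl⟩
          exact ⟨ha, by simp [← hp]⟩
      _ = (D + 1) * (r * r) := by rw [Nat.mul_div_cancel_left _ hr, Nat.succ_mul]
  -- Columns are the rows of the transposed grid.
  have h2 := learn_inGroup (D := D + 1) (X := X × N) (e.trans (Equiv.prodComm _ _))
    (Nat.succ_pos D) hr hc hc' (K := fun w => Setoid.ker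
        (held act loc₁ (fun p ω => (val p ω, dst p ω)) w)) (loc := loc₁)
    (val := fun p ω => (val p ω, dst p ω)) (fun p ω => (e (dst p ω)).1)
    (fun v => le_ker_held fun ω ω' hω p ha hl => by
      obtain ⟨h1, h2, h3⟩ := held_transfer hω ha hl
      have h4 : dst p ω' = dst p ω := congrArg Prod.snd h3
      exact ⟨h1, h2, Prod.ext h3 (by rw [h4])⟩) hs₁
    (fun ω g i => by
      refine (Set.ncard_le_ncard ?_ (Set.toFinite _)).trans (hs₂ ω (e.symm (i, g)))
      rintro p ⟨ha, rfl, rfl⟩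
      exact ⟨ha, by simp [loc₁, loc₂]⟩)
  have h3 := learn_inGroup (D := D + 1) (X := X × N) e
    (Nat.succ_pos D) hr hc hc' (K := fun w => Setoid.ker
        (held act loc₂ (fun p ω => (val p ω, dst p ω)) w)) (loc := loc₂)
    (val := fun p ω => (val p ω, dst p ω)) (fun p ω => (e (dst p ω)).2)
    (fun v => le_ker_held fun ω ω' hω p ha hl => by
      obtain ⟨h1, h2, h3⟩ := held_transfer hω ha hl
      have h4 : dst p ω' = dst p ω := congrArg Prod.snd h3
      exact ⟨h1, h2, Prod.ext h3 (by rw [h4])⟩) hs₂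
    (fun ω g i => by
      refine (Set.ncard_le_ncard ?_ (Set.toFinite _)).trans
        ((hd ω (e.symm (g, i))).trans (Nat.mul_le_mul_right _ (Nat.le_succ D)))
      rintro p ⟨ha, rfl, rfl⟩
      exact ⟨ha, by simp [loc₂]⟩)
  have e2 : (fun p ω => (e.trans (Equiv.prodComm _ _)).symm
      (((e.trans (Equiv.prodComm _ _)) (loc₁ p ω)).1, (e (dst p ω)).1)) = loc₂ := by
    funext p ω
    simp [loc₁, loc₂]
  have e3 : (fun p ω => e.symm ((e (loc₂ p ω)).1, (e (dst p ω)).2)) = dst := by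
    funext p ω
    simp [loc₂]
  rw [e2] at h2
  rw [e3] at h3
  rw [routeTime, two_mul (c' * 4 + _)]
  refine (h1.trans (h2.trans h3)).mono fun w => le_ker_held fun ω ω' hω p ha hl => ?_
  obtain ⟨h1, h2, h3⟩ := held_transfer hω ha hl
  exact ⟨h1, h2, congrArg Prod.fst h3⟩

end Grid

end CorePeriphery

/-! ### Core-periphery networks -/

namespace CorePeriphery

variable {V : Type u} {Ω : Type*} {N I : Type*} {B : ℕ} {G : SimpleGraph V} {C : Set V}

/-- A clique emulator delivers messages between all pairs of nodes of the core. -/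
theorem delivers_of_isCliqueEmulator {β : ℕ} (h : IsCliqueEmulator (G.induce C) B β) :
    Delivers Ω G B β (fun i : C × C => (i.1 : V)) (fun i => (i.2 : V)) := by
  classical
  obtain ⟨𝒜, h𝒜⟩ := h
  intro K f hf
  let st : ℕ → C → Ω → 𝒜.State := fun t v ω =>
    𝒜.run (fun v w => f (v, w) ω) (fun _ => ()) t v
  -- Each core node keeps track of its own state in the emulator; edges leaving the core carry
  -- constants.
  have key : ∀ t, Learn G B t K (gather (fun v : C => (v : V)) (st t)) := by
    intro t
    induction t with
    | zero =>
      refine fun w => le_gather fun v hv => ?_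
      subst hv
      intro x y hxy
      have : (fun w => f (v, w) x) = fun w => f (v, w) y := funext fun w => hf (v, w) hxy
      change 𝒜.init v (fun w => f (v, w) x) () = 𝒜.init v (fun w => f (v, w) y) ()
      rw [this]
    | succ t ih =>
      let μ : V → V → Ω → Msg B := fun v w ω =>
        if h : ∃ (hv : v ∈ C) (hw : w ∈ C), G.Adj v w then
          𝒜.send ⟨v, h.choose⟩ ⟨⟨w, h.choose_spec.choose⟩, h.choose_spec.choose_spec⟩
            (st t ⟨v, h.choose⟩ ω)
        else fun _ => false
      refine (ih.trans (Learn.single (μ := μ) fun v w _ => ?_)).mono fun w => le_gather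
        fun v hv => ?_
      · by_cases h : ∃ (hv : v ∈ C) (hw : w ∈ C), G.Adj v w
        · intro x y hxy
          have := gather_le (dst := fun v : C => (v : V)) (f := st t) ⟨v, h.choose⟩ hxy
          simp only [Setoid.ker_def] at this
          simp only [Setoid.ker_def, μ, dif_pos h, this]
        · intro x y hxy
          simp only [Setoid.ker_def, μ, dif_neg h]
      · subst hv
        intro x y hxy
        have h1 : st t v x = st t v y :=
          gather_le (dst := fun v : C => (v : V)) (f := st t) v hxy.1
        have h2 : ∀ w : (G.induce C).neighborSet v,
            𝒜.send w.1 ⟨v, w.2.symm⟩ (st t w.1 x) = 𝒜.send w.1 ⟨v, w.2.symm⟩ (st t w.1 y) := by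
          intro w
          have hwv : G.Adj w.1 v := w.2.symm
          have h : ∃ (_ : w.1.1 ∈ C) (_ : v.1 ∈ C), G.Adj w.1 v := ⟨w.1.2, v.2, hwv⟩
          have := congrFun hxy.2 ⟨w.1, hwv⟩
          simp only [μ, dif_pos h] at this
          exact this
        change 𝒜.update v (st t v x) (fun w => 𝒜.send w.1 ⟨v, w.2.symm⟩ (st t w.1 x)) =
          𝒜.update v (st t v y) (fun w => 𝒜.send w.1 ⟨v, w.2.symm⟩ (st t w.1 y))
        rw [h1, funext h2]
  refine (key β).mono fun w => le_gather fun i hi => ?_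
  subst hi
  intro x y hxy
  have h1 : st β i.2 x = st β i.2 y :=
    gather_le (dst := fun v : C => (v : V)) (f := st β) i.2 hxy
  have h2 : ∀ ω, 𝒜.out i.2 (st β i.2 ω) i.1 = f i ω := fun ω =>
    h𝒜 (fun v w => f (v, w) ω) i.1 i.2
  simp only [Setoid.ker_def, ← h2, h1]

/-- The knowledge of the nodes `n` as knowledge of the nodes `ι n`. -/
def pull (ι : N → V) (K : N → Setoid Ω) (v : V) : Setoid Ω :=
  ⨅ n, ⨅ (_ : ι n = v), K n

theorem pull_le {ι : N → V} {K : N → Setoid Ω} (n : N) : pull ι K (ι n) ≤ K n :=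
  iInf₂_le (f := fun m (_ : ι m = ι n) => K m) n rfl

theorem le_pull {ι : N → V} {K : N → Setoid Ω} {v : V} {L : Setoid Ω}
    (h : ∀ n, ι n = v → L ≤ K n) : L ≤ pull ι K v :=
  le_iInf₂ h

/-- Simulation of a clique. -/
theorem learn_simulate {β T : ℕ} {ι : N → V}
    (hβ : Delivers Ω G B β (fun i : N × N => ι i.1) (fun i => ι i.2))
    {κ κ' : N → Setoid Ω} (h : Learn (⊤ : SimpleGraph N) B T κ κ') {K : V → Setoid Ω}
    (hK : ∀ n, K (ι n) ≤ κ n) : Learn G B (T * β) K (pull ι κ') := by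
  classical
  induction T generalizing κ K with
  | zero =>
    rw [zero_mul]
    refine fun v => le_pull fun n hn => ?_
    subst hn
    exact (hK n).trans (h n)
  | succ T ih =>
    obtain ⟨μ, hμ, h⟩ := h
    rw [Nat.succ_mul, add_comm]
    -- The diagonal is blanked: `hμ` says nothing about messages of a node to itself.
    let g : N × N → Ω → Msg B := fun i => if i.1 = i.2 then fun _ _ => false else μ i.1 i.2
    have h1 := (hβ K g fun i => by
      simp only [g]
      split_ifs with hi
      · exact fun _ _ _ => rfl
      · exact (hK i.1).trans (hμ i.1 i.2 hi)).keep
    refine h1.trans (ih h fun n => le_inf (inf_le_left.trans (hK n)) ?_)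
    refine fun x y hxy => funext fun v => ?_
    have hg : g (v.1, n) = μ v.1 n := if_neg v.2
    have := gather_le (dst := fun i : N × N => ι i.2) (f := g) (v.1, n) hxy.2
    rw [hg] at this
    exact this

theorem delivers_simulate {β T : ℕ} {ι : N → V}
    (hβ : Delivers Ω G B β (fun i : N × N => ι i.1) (fun i => ι i.2)) {src dst : I → N}
    (h : Delivers Ω (⊤ : SimpleGraph N) B T src dst) :
    Delivers Ω G B (T * β) (ι ∘ src) (ι ∘ dst) := by
  intro K f hf
  refine (learn_simulate hβ (h (gather src f) f fun i => gather_le i) (K := pull ι (gather src f)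
    ⊓ K) fun n => inf_le_left.trans (pull_le n)).anti (le_inf (fun v => le_pull fun n hn =>
      le_gather fun i hi => ?_) le_rfl) |>.mono fun v => le_gather fun i hi => ?_
  · subst hn hi
    exact hf i
  · subst hi
    exact (pull_le (dst i)).trans (gather_le i)

/-- Messages can be delivered along walks of length `T` if no two of them use the same edge in the
same direction at the same time. -/
theorem delivers_schedule {T : ℕ} (pos : I → ℕ → V)
    (hadj : ∀ i, ∀ t < T, pos i t ≠ pos i (t + 1) → G.Adj (pos i t) (pos i (t + 1)))
    (huniq : ∀ i j, ∀ t < T, pos i t = pos j t → pos i (t + 1) = pos j (t + 1) →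
      pos i t ≠ pos i (t + 1) → i = j) :
    Delivers Ω G B T (fun i => pos i 0) (fun i => pos i T) := by
  classical
  intro K f hf
  have key : ∀ t ≤ T, Learn G B t K (gather (fun i => pos i t) f) := by
    intro t ht
    induction t with
    | zero =>
      refine fun w => le_gather fun i hi => ?_
      subst hi
      exact hf i
    | succ t ih =>
      let μ : V → V → Ω → Msg B := fun v w =>
        if h : ∃ i, pos i t = v ∧ pos i (t + 1) = w ∧ v ≠ w then f h.choose else fun _ _ => false
      have hμ : ∀ i, pos i t ≠ pos i (t + 1) → μ (pos i t) (pos i (t + 1)) = f i := by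
        intro i hi
        have h : ∃ j, pos j t = pos i t ∧ pos j (t + 1) = pos i (t + 1) ∧
          pos i t ≠ pos i (t + 1) := ⟨i, rfl, rfl, hi⟩
        simp only [μ, dif_pos h]
        rw [huniq _ i t ht h.choose_spec.1 h.choose_spec.2.1
          (by rw [h.choose_spec.1, h.choose_spec.2.1]; exact hi)]
      refine ((ih (by omega)).trans (Learn.single (μ := μ) fun v w _ => ?_)).mono
        fun w => le_gather fun i hi => ?_
      · by_cases h : ∃ i, pos i t = v ∧ pos i (t + 1) = w ∧ v ≠ w
        · obtain ⟨i, rfl, rfl, hne⟩ := h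
          rw [hμ i hne]
          exact gather_le i
        · simp only [μ, dif_neg h]
          exact fun _ _ _ => rfl
      · subst hi
        by_cases hne : pos i t = pos i (t + 1)
        · refine (hear_le _ _ _ _).trans ?_
          rw [← hne]
          exact gather_le (dst := fun i => pos i t) i
        · intro x y hxy
          have := congrFun hxy.2 ⟨pos i t, hadj i t ht hne⟩
          simp only [hμ i hne] at this
          exact this
  exact key T le_rfl

/-- Edges are undirected, so running the routes backwards in time creates no clash. -/
theorem delivers_schedule_reverse {T : ℕ} (pos : I → ℕ → V)
    (hadj : ∀ i, ∀ t < T, pos i t ≠ pos i (t + 1) → G.Adj (pos i t) (pos i (t + 1)))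
    (huniq : ∀ i j, ∀ t < T, pos i t = pos j t → pos i (t + 1) = pos j (t + 1) →
      pos i t ≠ pos i (t + 1) → i = j) :
    Delivers Ω G B T (fun i => pos i T) (fun i => pos i 0) := by
  have hsub : ∀ t < T, T - t = T - (t + 1) + 1 := fun t ht => by omega
  have h := delivers_schedule (Ω := Ω) (B := B) (G := G) (T := T) (fun i t => pos i (T - t))
    (fun i t ht hne => by
      rw [hsub t ht] at hne ⊢
      exact (hadj i _ (by omega) hne.symm).symm)
    (fun i j t ht h1 h2 hne => by
      rw [hsub t ht] at h1 hne
      exact huniq i j _ (by omega) h2 h1 hne.symm)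
  simpa using h

/-! ### Edge-disjoint routes from the periphery to the core -/

/-- The transmission of a message by a node of the periphery to a neighbour in some round. -/
abbrev Slot (G : SimpleGraph V) (C : Set V) (γ : ℕ) : Type u :=
  {s : V × V × Fin γ // s.1 ∉ C ∧ G.Adj s.1 s.2.1}

/-- The way in which a message got to its present place: it started there or it was transmitted. -/
abbrev Origin (G : SimpleGraph V) (C : Set V) (γ : ℕ) : Type u :=
  {v // v ∉ C} ⊕ Slot G C γ

/-- The node at which the message is. -/
def place {γ : ℕ} : Origin G C γ → V :=
  Sum.elim (fun v => v.1) (fun s => s.1.2.1)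

/-- The number of rounds after which the message is there. -/
def ready {γ : ℕ} : Origin G C γ → ℕ :=
  Sum.elim (fun _ => 0) (fun s => s.1.2.2 + 1)

/-- What is transmitted in the slots that lead out of `X` determines what reaches the core. -/
theorem card_le_of_isConvergecaster [Fintype V] {γ : ℕ} (hB : 0 < B)
    (h : IsConvergecaster G Cᶜ C B γ) (X : Set (Origin G C γ)) (hX : ∀ z ∈ X, place z ∉ C)
    (Y : Finset (Slot G C γ)) (hY : ∀ σ : Slot G C γ, Sum.inr σ ∉ X →
      (∃ z ∈ X, σ.1.1 = place z ∧ ready z ≤ σ.1.2.2) → σ ∈ Y)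
    (S : Finset {v // v ∉ C}) (hS : ∀ v, v ∈ S ↔ Sum.inl v ∈ X) : S.card ≤ Y.card := by
  classical
  obtain ⟨𝒜, h𝒜⟩ := h
  let inp : (V → Msg B) → V → ULift.{u} (Option (Msg B)) := fun M x =>
    ⟨@ite _ (x ∈ Cᶜ) (Classical.propDecidable _) (some (M x)) none⟩
  let st : (V → Msg B) → ℕ → V → 𝒜.State := fun M => 𝒜.run (inp M) (fun _ => ())
  -- A node not yet reached by `X` hears either from another such node or from a node that `X` has
  -- reached; the latter transmission leaves `X`, so its slot lies in `Y`.
  have key : ∀ M M' : V → Msg B,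
      (∀ v (hv : v ∉ C), Sum.inl ⟨v, hv⟩ ∉ X → M v = M' v) →
      (∀ σ ∈ Y, 𝒜.send σ.1.1 ⟨σ.1.2.1, σ.2.2⟩ (st M σ.1.2.2 σ.1.1) =
        𝒜.send σ.1.1 ⟨σ.1.2.1, σ.2.2⟩ (st M' σ.1.2.2 σ.1.1)) →
      ∀ t ≤ γ, ∀ v, (∀ z ∈ X, place z = v → t < ready z) → st M t v = st M' t v := by
    intro M M' hM hσ t
    induction t with
    | zero =>
      intro _ v hv
      have : inp M v = inp M' v := by
        by_cases hvC : v ∈ C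
        · simp [inp, hvC]
        · have := hM v hvC fun hmem => (hv _ hmem rfl).ne rfl
          simp [inp, this]
      change 𝒜.init v (inp M v) () = 𝒜.init v (inp M' v) ()
      rw [this]
    | succ t ih =>
      intro ht v hv
      have h1 : st M t v = st M' t v :=
        ih (by omega) v fun z hz hzv => (Nat.lt_succ_self t).trans (hv z hz hzv)
      have h2 : ∀ w : G.neighborSet v,
          𝒜.send w.1 ⟨v, w.2.symm⟩ (st M t w.1) = 𝒜.send w.1 ⟨v, w.2.symm⟩ (st M' t w.1) := by
        rintro ⟨w, hw⟩
        by_cases hcl : ∀ z ∈ X, place z = w → t < ready z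
        · rw [ih (by omega) w hcl]
        · push Not at hcl
          obtain ⟨z, hz, rfl, hzt⟩ := hcl
          let σ : Slot G C γ := ⟨(place z, v, ⟨t, ht⟩), hX z hz, hw.symm⟩
          refine hσ σ (hY σ (fun hmem => ?_) ⟨z, hz, rfl, hzt⟩)
          exact (hv _ hmem rfl).ne rfl
      change 𝒜.update v (st M t v) (fun w => 𝒜.send w.1 ⟨v, w.2.symm⟩ (st M t w.1)) =
        𝒜.update v (st M' t v) (fun w => 𝒜.send w.1 ⟨v, w.2.symm⟩ (st M' t w.1))
      rw [h1, funext h2]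
  let ext : (S → Msg B) → V → Msg B := fun m v =>
    if h : ∃ hv : v ∉ C, (⟨v, hv⟩ : {v // v ∉ C}) ∈ S then m ⟨⟨v, h.choose⟩, h.choose_spec⟩
    else fun _ => false
  -- With the other messages fixed, the transcript on `Y` determines the messages of `S`, since the
  -- core recovers them. Hence `2 ^ (B * |S|) ≤ 2 ^ (B * |Y|)`.
  let tr : (S → Msg B) → Y → Msg B := fun m σ =>
    𝒜.send σ.1.1.1 ⟨σ.1.1.2.1, σ.1.2.2⟩ (st (ext m) σ.1.1.2.2 σ.1.1.1)
  have htr : tr.Injective := by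
    intro m m' hmm
    have hst : ∀ c ∈ C, st (ext m) γ c = st (ext m') γ c := fun c hc =>
      key (ext m) (ext m') (fun v hv hvX => by
        have hne : ¬ ∃ hv : v ∉ C, (⟨v, hv⟩ : {v // v ∉ C}) ∈ S := by
          rintro ⟨hv', hvS⟩
          exact hvX ((hS _).1 hvS)
        simp only [ext, dif_neg hne]) (fun σ hσ => congrFun hmm ⟨σ, hσ⟩) γ le_rfl c
        fun z hz hzc => absurd (hzc ▸ hc) (hX z hz)
    funext ⟨⟨v, hv⟩, hvS⟩
    have hex : ∃ hv : v ∉ C, (⟨v, hv⟩ : {v // v ∉ C}) ∈ S := ⟨hv, hvS⟩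
    obtain ⟨⟨c, hc, hcv⟩, -⟩ := h𝒜 (ext m) v hv
    obtain ⟨-, hall⟩ := h𝒜 (ext m') v hv
    have hout : 𝒜.out c (st (ext m) γ c) v = some (ext m v) := hcv
    rw [hst c hc] at hout
    have := hall c hc _ hout
    simpa only [ext, dif_pos hex] using this
  have hcard := Fintype.card_le_of_injective tr htr
  simp only [Fintype.card_fun, Fintype.card_fin, Fintype.card_bool, Fintype.card_coe,
    ← pow_mul] at hcard
  exact Nat.le_of_mul_le_mul_left ((Nat.pow_le_pow_iff_right Nat.one_lt_two).1 hcard) hB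

/-- Hall's theorem gives edge-disjoint routes. -/
theorem exists_successor [Fintype V] {γ : ℕ} (hB : 0 < B) (h : IsConvergecaster G Cᶜ C B γ) :
    ∃ f : {z : Origin G C γ // place z ∉ C} → Slot G C γ, f.Injective ∧ ∀ z,
      ((f z).1.1 = place z.1 ∧ ready z.1 ≤ (f z).1.2.2) ∨ z.1 = Sum.inr (f z) := by
  classical
  -- A slot may be matched to itself, which means that it stays unused. This turns the search for
  -- disjoint routes into a matching problem.
  let t : {z : Origin G C γ // place z ∉ C} → Finset (Slot G C γ) := fun z =>
    Finset.univ.filter fun σ => (σ.1.1 = place z.1 ∧ ready z.1 ≤ σ.1.2.2) ∨ z.1 = Sum.inr σ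
  obtain ⟨f, hf, hft⟩ := (Finset.all_card_le_biUnion_card_iff_exists_injective t).1 fun s => by
    let X : Finset (Origin G C γ) := s.map (Function.Embedding.subtype _)
    have hX : ∀ z ∈ X, place z ∉ C := by
      intro z hz
      obtain ⟨z, -, rfl⟩ := Finset.mem_map.1 hz
      exact z.2
    let S : Finset {v // v ∉ C} := Finset.univ.filter fun v => Sum.inl v ∈ X
    let L : Finset (Slot G C γ) := Finset.univ.filter fun σ => Sum.inr σ ∈ X
    have hXSL : X = S.disjSum L := by
      ext z
      rcases z with v | σ <;> simp [S, L, Finset.mem_disjSum]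
    have hL : L ⊆ s.biUnion t := by
      intro σ hσ
      obtain ⟨z, hz, hzσ⟩ := Finset.mem_map.1 (Finset.mem_filter.1 hσ).2
      exact Finset.mem_biUnion.2 ⟨z, hz, Finset.mem_filter.2 ⟨Finset.mem_univ _, Or.inr hzσ⟩⟩
    -- Hall's condition: the candidates for `s` contain the slots `L` of `X` itself, and the slots
    -- leaving `X` are at least as many as the sources `S` in `X`.
    have hle := card_le_of_isConvergecaster hB h (X : Set (Origin G C γ)) hX (s.biUnion t \ L)
      (fun σ hσ ⟨z, hz, hz'⟩ => by
        obtain ⟨z, hzs, rfl⟩ := Finset.mem_map.1 hz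
        refine Finset.mem_sdiff.2 ⟨Finset.mem_biUnion.2 ⟨z, hzs, Finset.mem_filter.2
          ⟨Finset.mem_univ _, Or.inl hz'⟩⟩, fun hσL => hσ (Finset.mem_filter.1 hσL).2⟩)
      S (fun v => by simp [S])
    have h1 : s.card = S.card + L.card := by
      rw [← Finset.card_map (Function.Embedding.subtype _), ← Finset.card_disjSum, ← hXSL]
    have h2 := Finset.card_sdiff_add_card_eq_card hL
    omega
  exact ⟨f, hf, fun z => (Finset.mem_filter.1 (hft z)).2⟩

/-- The routes along which the periphery can send its messages to the core. -/
theorem exists_schedule [Fintype V] {γ : ℕ} (hB : 0 < B) (h : IsConvergecaster G Cᶜ C B γ) :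
    ∃ pos : V → ℕ → V, (∀ u, pos u 0 = u) ∧
      (∀ u, ∀ t < γ, pos u t ≠ pos u (t + 1) → G.Adj (pos u t) (pos u (t + 1))) ∧
      (∀ u u', ∀ t < γ, pos u t = pos u' t → pos u (t + 1) = pos u' (t + 1) →
        pos u t ≠ pos u (t + 1) → u = u') ∧
      (∀ u, pos u γ ∈ C) ∧
      ∀ c, {u | pos u γ = c}.ncard ≤ γ * degOut G C c + 1 := by
  classical
  obtain ⟨f, hf, hft⟩ := exists_successor hB h
  -- A message waits at its place until the round of the slot matched to it.
  let adv : ℕ → Origin G C γ → Origin G C γ := fun t z =>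
    if h : place z ∉ C then (if (f ⟨z, h⟩).1.2.2 = t then Sum.inr (f ⟨z, h⟩) else z) else z
  let Inv : ℕ → Origin G C γ → Prop := fun t z => ready z ≤ t ∧
    ∀ h : place z ∉ C, t ≤ (f ⟨z, h⟩).1.2.2 ∧ (f ⟨z, h⟩).1.1 = place z
  have hadv : ∀ t z, Inv t z → (adv t z = z ∧ ready (adv t z) ≤ t ∧
      ∀ h : place z ∉ C, t < (f ⟨z, h⟩).1.2.2) ∨
      ∃ h : place z ∉ C, adv t z = Sum.inr (f ⟨z, h⟩) ∧ ((f ⟨z, h⟩).1.2.2 : ℕ) = t ∧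
        (f ⟨z, h⟩).1.1 = place z := by
    intro t z hz
    by_cases hC : place z ∉ C
    · by_cases ht : ((f ⟨z, hC⟩).1.2.2 : ℕ) = t
      · exact Or.inr ⟨hC, by simp only [adv, dif_pos hC, if_pos ht], ht, (hz.2 hC).2⟩
      · have : adv t z = z := by simp only [adv, dif_pos hC, if_neg ht]
        exact Or.inl ⟨this, this.symm ▸ hz.1, fun h => lt_of_le_of_ne (hz.2 h).1 (Ne.symm ht)⟩
    · have : adv t z = z := by simp only [adv, dif_neg hC]
      exact Or.inl ⟨this, this.symm ▸ hz.1, fun h => absurd h hC⟩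
  have hInv : ∀ t z, Inv t z → Inv (t + 1) (adv t z) := by
    intro t z hz
    rcases hadv t z hz with ⟨he, -, hlt⟩ | ⟨hC, he, ht, -⟩
    · rw [he]
      exact ⟨hz.1.trans (Nat.le_succ t), fun h => ⟨hlt h, (hz.2 h).2⟩⟩
    · rw [he]
      have hrd : ready (Sum.inr (f ⟨z, hC⟩) : Origin G C γ) = t + 1 := congrArg (· + 1) ht
      refine ⟨hrd.le, fun h => ?_⟩
      rcases hft ⟨_, h⟩ with ⟨h1, h2⟩ | heq
      · exact ⟨hrd ▸ h2, h1⟩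
      -- A slot matched to itself is never entered: by injectivity it would equal `z`, which was
      -- ready earlier.
      · exfalso
        have := congrArg (fun z => ready z.1) (hf (Sum.inr_injective heq))
        simp only [hrd] at this
        have := hz.1
        omega
  have hinj : ∀ t z z', Inv t z → Inv t z' → adv t z = adv t z' → z = z' := by
    intro t z z' hz hz' heq
    rcases hadv t z hz with ⟨he, hr, -⟩ | ⟨hC, he, ht, -⟩ <;>
      rcases hadv t z' hz' with ⟨he', hr', -⟩ | ⟨hC', he', ht', -⟩
    · rw [← he, heq, he']
    · rw [heq, he'] at hr
      have hrd : ready (Sum.inr (f ⟨z', hC'⟩) : Origin G C γ) = t + 1 := congrArg (· + 1) ht'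
      omega
    · rw [← heq, he] at hr'
      have hrd : ready (Sum.inr (f ⟨z, hC⟩) : Origin G C γ) = t + 1 := congrArg (· + 1) ht
      omega
    · rw [he, he'] at heq
      exact congrArg Subtype.val (hf (Sum.inr_injective heq))
  let ptr : {v // v ∉ C} → ℕ → Origin G C γ := fun u t =>
    Nat.rec (Sum.inl u) (fun t z => adv t z) t
  have hptr : ∀ u t, Inv t (ptr u t) := by
    intro u t
    induction t with
    | zero =>
      refine ⟨le_rfl, fun h => ⟨Nat.zero_le _, ?_⟩⟩
      rcases hft ⟨_, h⟩ with ⟨h1, -⟩ | heq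
      · exact h1
      · exact absurd heq Sum.inl_ne_inr
    | succ t ih => exact hInv t _ ih
  have hptr_inj : ∀ t u u', ptr u t = ptr u' t → u = u' := by
    intro t
    induction t with
    | zero => exact fun u u' h => Sum.inl_injective h
    | succ t ih => exact fun u u' h => ih u u' (hinj t _ _ (hptr u t) (hptr u' t) h)
  have hend : ∀ u, place (ptr u γ) ∈ C := by
    intro u
    by_contra hC
    exact absurd ((hptr u γ).2 hC).1 (not_le.2 (Fin.is_lt _))
  let pos : V → ℕ → V := fun u t => if h : u ∉ C then place (ptr ⟨u, h⟩ t) else u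
  have hmove : ∀ u t, pos u t ≠ pos u (t + 1) → ∃ (hu : u ∉ C) (σ : Slot G C γ),
      ptr ⟨u, hu⟩ (t + 1) = Sum.inr σ ∧ σ.1.1 = pos u t ∧ σ.1.2.1 = pos u (t + 1) ∧
        (σ.1.2.2 : ℕ) = t := by
    intro u t hne
    by_cases hu : u ∉ C
    · simp only [pos, dif_pos hu] at hne ⊢
      rcases hadv t _ (hptr ⟨u, hu⟩ t) with ⟨he, -, -⟩ | ⟨hC, he, ht, htail⟩
      · exact absurd (congrArg place he).symm hne
      · exact ⟨hu, _, he, htail, (congrArg place he).symm, ht⟩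
    · simp only [pos, dif_neg hu] at hne
      exact absurd rfl hne
  refine ⟨pos, fun u => ?_, fun u t _ hne => ?_, fun u u' t _ h1 h2 hne => ?_, fun u => ?_,
    fun c => ?_⟩
  · by_cases hu : u ∉ C
    · simp only [pos, dif_pos hu]
      rfl
    · simp only [pos, dif_neg hu]
  · obtain ⟨hu, σ, -, h1, h2, -⟩ := hmove u t hne
    rw [← h1, ← h2]
    exact σ.2.2
  · obtain ⟨hu, σ, hσ, hσ1, hσ2, hσ3⟩ := hmove u t hne
    obtain ⟨hu', σ', hσ', hσ1', hσ2', hσ3'⟩ := hmove u' t (by rwa [← h1, ← h2])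
    have : σ = σ' := Subtype.ext (Prod.ext (by rw [hσ1, hσ1', h1])
      (Prod.ext (by rw [hσ2, hσ2', h2]) (Fin.ext (by rw [hσ3, hσ3']))))
    exact congrArg Subtype.val (hptr_inj (t + 1) _ _ (hσ.trans (this ▸ hσ'.symm)))
  · by_cases hu : u ∉ C
    · simp only [pos, dif_pos hu]
      exact hend _
    · simp only [pos, dif_neg hu]
      exact not_not.1 hu
  -- A route from the periphery that ends at `c` is determined by the round and the tail of its last
  -- slot; the extra `1` is the constant route of `c`.
  · have hsub : {u | pos u γ = c} ⊆ {u | ∃ hu : u ∉ C, place (ptr ⟨u, hu⟩ γ) = c} ∪ {c} := by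
      intro u hu
      by_cases huC : u ∉ C
      · left
        have hu' : pos u γ = c := hu
        simp only [pos, dif_pos huC] at hu'
        exact ⟨huC, hu'⟩
      · right
        have hu' : pos u γ = c := hu
        simp only [pos, dif_neg huC] at hu'
        exact hu'
    refine (Set.ncard_le_ncard hsub (Set.toFinite _)).trans ((Set.ncard_union_le _ _).trans ?_)
    rw [Set.ncard_singleton]
    refine Nat.add_le_add_right ?_ 1
    have hslot : ∀ u (hu : u ∉ C), ∃ σ, ptr ⟨u, hu⟩ γ = Sum.inr σ := by
      intro u hu
      rcases hz : ptr ⟨u, hu⟩ γ with v | σ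
      · have := hend ⟨u, hu⟩
        rw [hz] at this
        exact absurd this v.2
      · exact ⟨σ, rfl⟩
    rcases Set.eq_empty_or_nonempty {u | ∃ hu : u ∉ C, place (ptr ⟨u, hu⟩ γ) = c} with h0 | hne
    · simp [h0]
    have : Nonempty (Slot G C γ) := hne.elim fun u ⟨hu, _⟩ => (hslot u hu).nonempty
    choose! σ hσ using hslot
    calc {u | ∃ hu : u ∉ C, place (ptr ⟨u, hu⟩ γ) = c}.ncard
        ≤ ((Set.univ : Set (Fin γ)) ×ˢ (G.neighborSet c ∩ Cᶜ)).ncard := by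
          refine Set.ncard_le_ncard_of_injOn (fun u => ((σ u).1.2.2, (σ u).1.1)) ?_ ?_
            (Set.toFinite _)
          · rintro u ⟨hu, hc⟩
            rw [hσ u hu] at hc
            obtain rfl : (σ u).1.2.1 = c := hc
            exact ⟨trivial, (σ u).2.2.symm, (σ u).2.1⟩
          · rintro u ⟨hu, hc⟩ u' ⟨hu', hc'⟩ heq
            rw [hσ u hu] at hc
            rw [hσ u' hu'] at hc'
            have heq := Prod.ext_iff.1 heq
            have : σ u = σ u' := Subtype.ext (Prod.ext heq.2
              (Prod.ext (Eq.trans hc (Eq.symm hc')) heq.1))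
            exact congrArg Subtype.val (hptr_inj γ _ _
              ((hσ u hu).trans (this ▸ (hσ u' hu').symm)))
      _ = γ * degOut G C c := by
          rw [Set.ncard_prod, Set.ncard_univ, Nat.card_fin, degOut]

end CorePeriphery

/-! ### Hosting the nodes of the network in a square grid of core nodes -/

namespace CorePeriphery

variable {V : Type u} {Ω : Type*} {B : ℕ} {G : SimpleGraph V} {C : Set V}

/-- The number of nodes that a node of the grid hosts is at most this constant times the size of
the grid. -/
noncomputable def hostLoad (α : ℝ) (γ : ℕ) : ℕ := 16 * (γ * ⌈α⌉₊ + 1)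

/-- The time for sending one message from every node to its host. -/
noncomputable def hostTime (α : ℝ) (β γ : ℕ) : ℕ := γ + 4 * hostLoad α γ * β

/-- The `+ 1` in the balance condition is harmless, because `c` is not among its own neighbours in
`C`. -/
theorem degOut_le [Finite V] {α : ℝ} (h : HasBalancedBoundary G C α) {c : V} (hc : c ∈ C) :
    degOut G C c ≤ ⌈α⌉₊ * Nat.card C := by
  have h1 : degIn G C c + 1 ≤ Nat.card C := by
    rw [Nat.card_coe_set_eq]
    refine Nat.succ_le_of_lt (Set.ncard_lt_ncard ⟨Set.inter_subset_right, fun h => ?_⟩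
      (Set.toFinite _))
    exact G.irrefl (h hc).1
  have h2 := (div_le_iff₀ (by positivity)).1 (h c hc)
  have h3 : (degOut G C c : ℝ) ≤ (⌈α⌉₊ * Nat.card C : ℕ) := by
    refine h2.trans ?_
    push_cast
    exact mul_le_mul (Nat.le_ceil α) (by exact_mod_cast h1) (by positivity) (by positivity)
  exact_mod_cast h3

/-- The ends `ρ u` of the routes need not lie in the grid. The assignment to hosts `g` is a fixed
balanced one, so moving between `ρ u` and the host of `u` is a static pattern in the core. -/
theorem exists_hosting [Fintype V] [Nonempty V] {α : ℝ} {β γ : ℕ} (hB : 0 < B)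
    (h : IsCorePeriphery G C α β γ B) (Ω : Type*) :
    ∃ (r : ℕ) (ι : Fin r × Fin r → V) (g : V → Fin r × Fin r), 0 < r ∧
      r * r ≤ Nat.card V ∧
      (∀ x, {u | g u = x}.ncard ≤ hostLoad α γ * (r * r)) ∧
      Delivers Ω G B β (fun i : (Fin r × Fin r) × (Fin r × Fin r) => ι i.1) (fun i => ι i.2) ∧
      Delivers Ω G B (hostTime α β γ) id (ι ∘ g) ∧
      Delivers Ω G B (hostTime α β γ) (ι ∘ g) id := by
  classical
  obtain ⟨pos, hpos0, hadj, huniq, hposC, hload⟩ := exists_schedule hB h.convergecast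
  set E := γ * ⌈α⌉₊ + 1 with hE
  set m := Nat.card C with hm
  let ρ : V → C := fun u => ⟨pos u γ, hposC u⟩
  have : Nonempty C := ‹Nonempty V›.map ρ
  have hm0 : 0 < m := Nat.card_pos
  have hρ : ∀ c, {u | ρ u = c}.ncard ≤ E * m := by
    intro c
    have h1 : {u | ρ u = c} = {u | pos u γ = c} := Set.ext fun u => Subtype.ext_iff
    rw [h1]
    refine (hload c).trans ?_
    calc γ * degOut G C c + 1 ≤ γ * (⌈α⌉₊ * m) + m :=
          add_le_add (Nat.mul_le_mul_left _ (degOut_le h.boundary c.2)) hm0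
      _ = E * m := by rw [hE]; ring
  have hn : Nat.card V ≤ m * (E * m) := by
    rw [← Set.ncard_univ, show (Set.univ : Set V) = {u | True} from Set.ext fun _ => by simp,
      ncard_eq_sum_fibres _ ρ]
    refine (Finset.sum_le_card_nsmul _ _ (E * m) fun c _ => ?_).trans ?_
    · simpa only [true_and] using hρ c
    · rw [Finset.card_univ, ← Nat.card_eq_fintype_card, smul_eq_mul]
  set r := Nat.sqrt m with hr
  have hr0 : 0 < r := Nat.sqrt_pos.2 hm0
  have hrm : r * r ≤ m := Nat.sqrt_le m
  have hmr : m ≤ 4 * (r * r) := by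
    have h1 : m < (r + 1) * (r + 1) := Nat.lt_succ_sqrt m
    nlinarith
  -- The factor 16 in `hostLoad` comes from using `m ≤ 4 * (r * r)` twice.
  have hnW : Nat.card V ≤ hostLoad α γ * (r * r) * (r * r) := by
    calc Nat.card V ≤ m * (E * m) := hn
      _ ≤ (4 * (r * r)) * (E * (4 * (r * r))) :=
        Nat.mul_le_mul hmr (Nat.mul_le_mul_left _ hmr)
      _ = hostLoad α γ * (r * r) * (r * r) := by rw [hostLoad, ← hE]; ring
  obtain ⟨ι₀⟩ : Nonempty (Fin r × Fin r ↪ C) := by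
    refine Function.Embedding.nonempty_of_card_le ?_
    rw [← Nat.card_eq_fintype_card (α := C), Fintype.card_prod, Fintype.card_fin]
    exact hrm
  obtain ⟨φ⟩ : Nonempty (V ↪ Fin (hostLoad α γ * (r * r)) × (Fin r × Fin r)) := by
    refine Function.Embedding.nonempty_of_card_le ?_
    rw [← Nat.card_eq_fintype_card (α := V)]
    simpa using hnW
  let g : V → Fin r × Fin r := fun u => (φ u).2
  have hg : ∀ x, {u | g u = x}.ncard ≤ hostLoad α γ * (r * r) := by
    intro x
    rw [← Nat.card_fin (hostLoad α γ * (r * r)), ← Set.ncard_univ]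
    refine Set.ncard_le_ncard_of_injOn (fun u => (φ u).1) (fun _ _ => trivial) ?_ (Set.toFinite _)
    intro u hu u' hu' heq
    exact φ.injective (Prod.ext heq (Eq.trans hu (Eq.symm hu')))
  have hem := delivers_of_isCliqueEmulator (Ω := Ω) h.emulation
  have hEW : E * m ≤ hostLoad α γ * m := Nat.mul_le_mul_right _ (by rw [hostLoad]; omega)
  have hg' : ∀ c, {u | ι₀ (g u) = c}.ncard ≤ hostLoad α γ * m := by
    intro c
    by_cases hc : ∃ x, ι₀ x = c
    · obtain ⟨x, rfl⟩ := hc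
      simp only [EmbeddingLike.apply_eq_iff_eq]
      exact (hg x).trans (Nat.mul_le_mul_left _ hrm)
    · have : {u | ι₀ (g u) = c} = ∅ :=
        Set.eq_empty_of_forall_notMem fun u hu => hc ⟨g u, hu⟩
      simp [this]
  have up := delivers_static (Ω := Ω) (B := B) (src := ρ) (dst := fun u => ι₀ (g u))
    (fun c => (hρ c).trans hEW) hg'
  have down := delivers_static (Ω := Ω) (B := B) (src := fun u => ι₀ (g u)) (dst := ρ)
    hg' (fun c => (hρ c).trans hEW)
  have hid : (fun u => pos u 0) = id := funext hpos0
  refine ⟨r, fun x => ι₀ x, g, hr0, hrm.trans ?_, hg, ?_, ?_, ?_⟩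
  · rw [hm, Nat.card_coe_set_eq]
    exact Set.ncard_le_card C
  · exact hem.comp (Prod.map ι₀ ι₀) (ι₀.injective.prodMap ι₀.injective)
  · have h1 := delivers_schedule (Ω := Ω) (B := B) pos hadj huniq
    rw [hid] at h1
    exact h1.trans (delivers_simulate hem up)
  · have h1 := delivers_schedule_reverse (Ω := Ω) (B := B) pos hadj huniq
    rw [hid] at h1
    exact ((delivers_simulate hem down).trans h1).mono_time (by rw [hostTime, add_comm])

/-! ### Counting the values that are sent -/

section Counting

variable {ι Y : Type*}

/-- Partial functions with at most `t` values. -/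
abbrev SparseFun (ι Y : Type*) (t : ℕ) : Type _ :=
  {f : ι → Option Y // {i | f i ≠ none}.ncard ≤ t}

/-- Such a function is encoded by the list of its at most `t` argument-value pairs, padded with
`none`. -/
theorem card_sparseFun_le [Finite ι] [Finite Y] (t : ℕ) :
    Nat.card (SparseFun ι Y t) ≤ (Nat.card ι * Nat.card Y + 1) ^ t := by
  classical
  have hcard : (Nat.card ι * Nat.card Y + 1) ^ t = Nat.card (Fin t → Option (ι × Y)) := by
    rw [Nat.card_fun, Nat.card_fin, Finite.card_option, Nat.card_prod]
  rw [hcard]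
  let enc : SparseFun ι Y t → Fin t → Option (ι × Y) := fun f l =>
    pick fun z => f.1 z.1 = some z.2 ∧ rank {i | f.1 i ≠ none} z.1 = l
  have henc : ∀ f l i y, enc f l = some (i, y) ↔
      f.1 i = some y ∧ rank {i | f.1 i ≠ none} i = l := by
    intro f l i y
    refine pick_eq_some ?_
    rintro ⟨i, y⟩ ⟨i', y'⟩ ⟨h1, h2⟩ ⟨h1', h2'⟩
    have hi : i ∈ {i | f.1 i ≠ none} := Option.ne_none_iff_exists'.2 ⟨y, h1⟩
    have hi' : i' ∈ {i | f.1 i ≠ none} := Option.ne_none_iff_exists'.2 ⟨y', h1'⟩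
    obtain rfl : i = i' := rank_inj hi hi' (h2.trans h2'.symm)
    exact Prod.ext rfl (Option.some_injective _ (h1.symm.trans h1'))
  have hiff : ∀ f i y, f.1 i = some y ↔ ∃ l, enc f l = some (i, y) := by
    intro f i y
    constructor
    · intro h
      have hi : i ∈ {i | f.1 i ≠ none} := Option.ne_none_iff_exists'.2 ⟨y, h⟩
      exact ⟨⟨_, (rank_lt hi).trans_le f.2⟩, (henc _ _ _ _).2 ⟨h, rfl⟩⟩
    · rintro ⟨l, h⟩
      exact ((henc _ _ _ _).1 h).1
  refine Nat.card_le_card_of_injective enc fun f f' h => Subtype.ext (funext fun i =>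
    Option.ext fun y => ?_)
  rw [hiff, hiff, h]

theorem ncard_le_mul {P Q : Type*} [Finite P] [Finite Q] {S : Set P} {T : Set Q} (f : P → Q)
    {t : ℕ} (hf : ∀ p ∈ S, f p ∈ T) (ht : ∀ y ∈ T, {p | p ∈ S ∧ f p = y}.ncard ≤ t) :
    S.ncard ≤ t * T.ncard := by
  classical
  have := Fintype.ofFinite P
  have := Fintype.ofFinite Q
  rw [Set.ncard_eq_toFinset_card' S, Set.ncard_eq_toFinset_card' T]
  refine Finset.card_le_mul_card_image_of_maps_to (f := f) (fun p hp => ?_) t fun y hy => ?_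
  · simpa using hf p (by simpa using hp)
  · refine le_trans (le_of_eq ?_) (ht y (by simpa using hy))
    rw [← Set.ncard_coe_finset]
    congr 1
    ext p
    simp

end Counting

end CorePeriphery

/-! ### Vector by matrix multiplication -/

namespace CorePeriphery

section Problem

variable {V : Type u} {n : ℕ} {R : Type u} [Semiring R] {D : Finset R} {t : ℕ}

/-- An input of the task, together with its distribution to the nodes. -/
structure Instance (V : Type u) (n : ℕ) {R : Type u} [Semiring R] (D : Finset R) (t : ℕ) :
    Type u where
  σ : V ≃ Fin n
  τ : V ≃ Fin n
  s : Fin n → R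
  A : Matrix (Fin n) (Fin n) R
  s_mem : ∀ i, s i ∈ D
  A_mem : ∀ i j, A i j ∈ D
  sparse : IsSparse t A

namespace Instance

/-- What the nodes hold initially. -/
def input (ω : Instance V n D t) (v : V) : VMMInput n R :=
  vmmInput ω.σ ω.τ ω.s ω.A v

/-- An entry of the vector. -/
def entry (ω : Instance V n D t) (i : Fin n) : D := ⟨ω.s i, ω.s_mem i⟩

open Classical in
/-- The nonzero entries of a row of the matrix. -/
noncomputable def row (ω : Instance V n D t) (i : Fin n) : SparseFun (Fin n) D t :=
  ⟨fun j => if ω.A i j ≠ 0 then some ⟨ω.A i j, ω.A_mem i j⟩ else none, by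
    simpa using ω.sparse.1 i⟩

open Classical in
/-- The nonzero entries of a column of the matrix, and the corresponding entries of the vector. -/
noncomputable def col (ω : Instance V n D t) (j : Fin n) : SparseFun (Fin n) (D × D) t :=
  ⟨fun i => if ω.A i j ≠ 0 then some (ω.entry i, ⟨ω.A i j, ω.A_mem i j⟩) else none, by
    simpa using ω.sparse.2 j⟩

/-- An entry of the product is a sum over the nonzero entries of a column. -/
theorem vecMul_eq (ω : Instance V n D t) (j : Fin n) :
    (ω.s ᵥ* ω.A) j = ∑ i, ((ω.col j).1 i).elim 0 fun p => (p.1 : R) * (p.2 : R) := by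
  rw [Matrix.vecMul, dotProduct]
  refine Finset.sum_congr rfl fun i _ => ?_
  by_cases h : ω.A i j = 0
  · simp [col, h]
  · simp [col, h, entry]

/-- What a node tells its host. -/
noncomputable def report (u : V) (ω : Instance V n D t) :
    (Fin n × D) × (Fin n × SparseFun (Fin n) D t) :=
  ((ω.σ u, ω.entry (ω.σ u)), (ω.τ u, ω.row (ω.τ u)))

theorem row_eq_of_input_eq {ω ω' : Instance V n D t} {u : V} (h : ω.input u = ω'.input u) :
    ω.row (ω.τ u) = ω'.row (ω'.τ u) := by
  have h1 : ω.A (ω.τ u) = ω'.A (ω'.τ u) := congrArg VMMInput.row h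
  refine Subtype.ext (funext fun j => ?_)
  by_cases hA : ω'.A (ω'.τ u) j = 0 <;> simp [row, h1, hA]

theorem ker_input_le (u : V) :
    Setoid.ker (fun ω : Instance V n D t => ω.input u) ≤ Setoid.ker (report u) := by
  intro ω ω' h
  have h1 : ω.σ u = ω'.σ u := congrArg VMMInput.entryIdx h
  have h2 : ω.s (ω.σ u) = ω'.s (ω'.σ u) := congrArg VMMInput.entry h
  have h3 : ω.τ u = ω'.τ u := congrArg VMMInput.rowIdx h
  have h4 := row_eq_of_input_eq h
  have h5 : ω.entry (ω.σ u) = ω'.entry (ω'.σ u) := Subtype.ext h2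
  simp only [Setoid.ker_def, report]
  rw [h4, h5, h1, h3]

theorem entry_eq_of_row_eq {ω ω' : Instance V n D t} {i : Fin n} (h : ω.row i = ω'.row i)
    (j : Fin n) : ω.A i j = ω'.A i j := by
  have h1 := congrFun (congrArg Subtype.val h) j
  simp only [row] at h1
  split_ifs at h1 with h2 h3 h3
  · exact congrArg Subtype.val (Option.some_injective _ h1)
  · rw [not_not] at h2 h3
    rw [h2, h3]

end Instance

end Problem

/-! ### The computation in the grid -/

section Grid

variable {V : Type u} [Fintype V] {n : ℕ} {R : Type u} [Semiring R] {D : Finset R} {t : ℕ}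
  {r W B x y : ℕ}

/-- The number of rounds for the computation in the grid. -/
def gridTime (W t x y : ℕ) : ℕ :=
  3 * routeTime W (x + 5) (W + 2) + routeTime (W * t) (y + 5) (W * t + 2)

/-- Lengths are counted in blocks of `L` bits. A packet needs 2 for its name, `x` for its value, 2
for two grid nodes and 1 for `none`. A count needs `D + 2` by the crude bound `D + 1 ≤ 2 ^ (L * D)`.
-/
theorem learn_grid_route {P X Ω : Type*} [Finite P] [Finite X] {L D : ℕ} (hr : 0 < r)
    (hL : 0 < L) (hLB : L ≤ B)
    (hrL : r * r ≤ 2 ^ L) (hP : Nat.card P ≤ 2 ^ (L * 2)) (hX : Nat.card X ≤ 2 ^ (L * x))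
    {K : Fin r × Fin r → Setoid Ω} {act : P → Ω → Prop} {loc dst : P → Ω → Fin r × Fin r}
    {val : P → Ω → X}
    (hK : ∀ v, K v ≤ Setoid.ker (held act loc (fun p ω => (val p ω, dst p ω)) v))
    (hs : ∀ ω v, {p | act p ω ∧ loc p ω = v}.ncard ≤ D * (r * r))
    (hd : ∀ ω v, {p | act p ω ∧ dst p ω = v}.ncard ≤ D * (r * r)) :
    Learn (⊤ : SimpleGraph (Fin r × Fin r)) B (routeTime D (x + 5) (D + 2)) K
      (fun w => Setoid.ker (held act dst val w)) := by
  have hsucc : ∀ {a c : ℕ}, a ≤ 2 ^ (L * c) → a + 1 ≤ 2 ^ (L * (c + 1)) := by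
    intro a c h
    have h1 : 2 ^ 1 ≤ 2 ^ L := Nat.pow_le_pow_right two_pos hL
    have h2 : 0 < 2 ^ (L * c) := by positivity
    rw [Nat.mul_succ, pow_add]
    nlinarith
  have hBL : ∀ c, 2 ^ (L * c) ≤ 2 ^ (B * c) := fun c =>
    Nat.pow_le_pow_right two_pos (Nat.mul_le_mul_right c hLB)
  refine learn_route (Equiv.refl _) hr ?_ ?_ hK hs hd
  · refine le_trans ?_ (hBL _)
    rw [Finite.card_option]
    refine hsucc ?_
    simp only [Nat.card_prod, Nat.card_fin]
    calc Nat.card P * (Nat.card X * (r * r) * (r * r))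
        ≤ 2 ^ (L * 2) * (2 ^ (L * x) * 2 ^ L * 2 ^ L) := by gcongr
      _ = 2 ^ (L * (x + 4)) := by
        rw [← pow_add, ← pow_add, ← pow_add]
        congr 1
        ring
  · refine le_trans ?_ (hBL _)
    refine hsucc ?_
    calc (D + 1) * (r * r) ≤ 2 ^ (L * D) * 2 ^ L := by
          refine Nat.mul_le_mul ?_ hrL
          exact (Nat.lt_two_pow_self (n := D)).trans_le (Nat.pow_le_pow_right two_pos
            (Nat.le_mul_of_pos_left D hL))
      _ = 2 ^ (L * (D + 1)) := by rw [← pow_add]; rfl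

theorem learn_grid {L : ℕ} (hr : 0 < r) (hL : 0 < L) (hLB : L ≤ B) (hrL : r * r ≤ 2 ^ L)
    (hn : n ≤ 2 ^ L) (e : V ≃ Fin n) (g : V → Fin r × Fin r)
    (hg : ∀ v, {u | g u = v}.ncard ≤ W * (r * r))
    (h₁ : Nat.card (Fin n × D) ≤ 2 ^ (L * x))
    (h₂ : Nat.card (Fin n × SparseFun (Fin n) D t) ≤ 2 ^ (L * x))
    (h₃ : Nat.card (D × D) ≤ 2 ^ (L * y))
    (h₄ : Nat.card (SparseFun (Fin n) (D × D) t) ≤ 2 ^ (L * x)) :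
    Learn (⊤ : SimpleGraph (Fin r × Fin r)) B (gridTime W t x y)
      (gather g (Instance.report (V := V) (n := n) (D := D) (t := t)))
      (gather g fun u ω => ω.col (ω.σ u)) := by
  classical
  -- The host of an index is given by the fixed numbering `e`, so all nodes know it, whereas `σ` and
  -- `τ` are part of the input.
  let h : Fin n → Fin r × Fin r := fun i => g (e.symm i)
  have hh : ∀ v, {i | h i = v}.ncard ≤ W * (r * r) := fun v => by
    refine (Set.ncard_le_ncard_of_injOn e.symm ?_ (fun _ _ _ _ h => e.symm.injective h)
      (Set.toFinite _)).trans (hg v)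
    exact fun i hi => hi
  have hperm : ∀ (π : V ≃ Fin n) v, {u | True ∧ h (π u) = v}.ncard ≤ W * (r * r) := fun π v => by
    refine (Set.ncard_le_ncard_of_injOn π ?_ (fun _ _ _ _ h => π.injective h)
      (Set.toFinite _)).trans (hh v)
    exact fun i hi => hi.2
  have hcV : Nat.card V ≤ 2 ^ (L * 2) := by
    rw [Nat.card_congr e, Nat.card_fin]
    exact hn.trans (Nat.pow_le_pow_right two_pos (by omega))
  set K₀ := gather g (Instance.report (V := V) (n := n) (D := D) (t := t)) with hK₀
  have hrep : ∀ {u ω ω'}, K₀ (g u) ω ω' → Instance.report u ω = Instance.report u ω' :=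
    fun {u ω ω'} H => gather_le u H
  -- the entries of the vector
  have s₁ := learn_grid_route (K := K₀) (act := fun (_ : V) _ => True) (loc := fun u _ => g u)
    (dst := fun u ω => h (ω.σ u)) (val := fun u ω => (ω.σ u, ω.entry (ω.σ u)))
    hr hL hLB hrL hcV h₁
    (fun v => le_ker_held fun ω ω' hω u _ hu => by
      subst hu
      have h1 := congrArg Prod.fst (hrep hω)
      have h2 : ω.σ u = ω'.σ u := congrArg Prod.fst h1
      exact ⟨trivial, rfl, Prod.ext h1.symm (congrArg h h2.symm)⟩)
    (fun ω v => by simpa using hg v) (fun ω v => hperm ω.σ v)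
  -- the rows of the matrix
  have s₂ := learn_grid_route (K := K₀) (act := fun (_ : V) _ => True) (loc := fun u _ => g u)
    (dst := fun u ω => h (ω.τ u)) (val := fun u ω => (ω.τ u, ω.row (ω.τ u)))
    hr hL hLB hrL hcV h₂
    (fun v => le_ker_held fun ω ω' hω u _ hu => by
      subst hu
      have h1 := congrArg Prod.snd (hrep hω)
      have h2 : ω.τ u = ω'.τ u := congrArg Prod.fst h1
      exact ⟨trivial, rfl, Prod.ext h1.symm (congrArg h h2.symm)⟩)
    (fun ω v => by simpa using hg v) (fun ω v => hperm ω.τ v)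
  set K₁ : Fin r × Fin r → Setoid (Instance V n D t) := fun w => Setoid.ker
    (held (fun (_ : V) _ => True) (fun u ω => h (ω.σ u))
      (fun u ω => (ω.σ u, ω.entry (ω.σ u))) w) with hK₁
  set K₂ : Fin r × Fin r → Setoid (Instance V n D t) := fun w => Setoid.ker
    (held (fun (_ : V) _ => True) (fun u ω => h (ω.τ u))
      (fun u ω => (ω.τ u, ω.row (ω.τ u))) w) with hK₂
  have hσ : ∀ {i ω ω'}, K₁ (h i) ω ω' → ω'.σ.symm i = ω.σ.symm i ∧ ω'.entry i = ω.entry i := by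
    intro i ω ω' H
    obtain ⟨-, -, h3⟩ := held_transfer H (p := ω.σ.symm i) trivial (by simp)
    obtain ⟨h4, h5⟩ := Prod.ext_iff.1 h3
    simp only [Equiv.apply_symm_apply] at h4 h5
    rw [h4] at h5
    exact ⟨(Equiv.symm_apply_eq _).2 h4.symm, h5⟩
  have hτ : ∀ {i ω ω'}, K₂ (h i) ω ω' → ω'.row i = ω.row i := by
    intro i ω ω' H
    obtain ⟨-, -, h3⟩ := held_transfer H (p := ω.τ.symm i) trivial (by simp)
    obtain ⟨h4, h5⟩ := Prod.ext_iff.1 h3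
    simp only [Equiv.apply_symm_apply] at h4 h5
    rwa [h4] at h5
  have hcnn : Nat.card (Fin n × Fin n) ≤ 2 ^ (L * 2) := by
    rw [Nat.card_prod, Nat.card_fin, mul_two, pow_add]
    exact Nat.mul_le_mul hn hn
  -- the products
  have s₃ := learn_grid_route (K := K₁ ⊓ K₂) (D := W * t)
    (act := fun (p : Fin n × Fin n) (ω : Instance V n D t) => ω.A p.1 p.2 ≠ 0)
    (loc := fun p _ => h p.1) (dst := fun p _ => h p.2)
    (val := fun p ω => (ω.entry p.1, (⟨ω.A p.1 p.2, ω.A_mem _ _⟩ : D)))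
    hr hL hLB hrL hcnn h₃
    (fun v => le_ker_held fun ω ω' hω p ha hp => by
      subst hp
      have h1 := Instance.entry_eq_of_row_eq (hτ hω.2) p.2
      refine ⟨?_, rfl, ?_⟩
      · simpa only [h1] using ha
      · simp only [h1, (hσ hω.1).2])
    (fun ω v => by
      refine (ncard_le_mul (T := {i | h i = v}) Prod.fst (fun p hp => hp.2) (t := t)
        fun i _ => ?_).trans ((Nat.mul_le_mul_left t (hh v)).trans (le_of_eq (by ring)))
      refine (Set.ncard_le_ncard_of_injOn Prod.snd ?_ ?_ (Set.toFinite _)).trans (ω.sparse.1 i)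
      · rintro p ⟨⟨hp, -⟩, rfl⟩
        exact hp
      · rintro p ⟨-, hp⟩ p' ⟨-, hp'⟩ heq
        exact Prod.ext (hp.trans hp'.symm) heq)
    (fun ω v => by
      refine (ncard_le_mul (T := {i | h i = v}) Prod.snd (fun p hp => hp.2) (t := t)
        fun i _ => ?_).trans ((Nat.mul_le_mul_left t (hh v)).trans (le_of_eq (by ring)))
      refine (Set.ncard_le_ncard_of_injOn Prod.fst ?_ ?_ (Set.toFinite _)).trans (ω.sparse.2 i)
      · rintro p ⟨⟨hp, -⟩, rfl⟩
        exact hp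
      · rintro p ⟨-, hp⟩ p' ⟨-, hp'⟩ heq
        exact Prod.ext heq (hp.trans hp'.symm))
  set K₃ : Fin r × Fin r → Setoid (Instance V n D t) := fun w => Setoid.ker
    (held (fun (p : Fin n × Fin n) (ω : Instance V n D t) => ω.A p.1 p.2 ≠ 0)
      (fun p _ => h p.2) (fun p ω => (ω.entry p.1, (⟨ω.A p.1 p.2, ω.A_mem _ _⟩ : D))) w) with hK₃
  have hcol : ∀ {j ω ω'}, K₃ (h j) ω ω' → ω'.col j = ω.col j := by
    intro j ω ω' H
    refine Subtype.ext (funext fun i => Option.ext fun z => ?_)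
    have H' := congrFun H (i, j)
    have hcolheld : ∀ ω : Instance V n D t, (ω.col j).1 i =
        held (fun (p : Fin n × Fin n) (ω : Instance V n D t) => ω.A p.1 p.2 ≠ 0)
          (fun p _ => h p.2) (fun p ω => (ω.entry p.1, (⟨ω.A p.1 p.2, ω.A_mem _ _⟩ : D)))
          (h j) ω (i, j) := by
      intro ω
      by_cases hA : ω.A i j = 0 <;> simp [Instance.col, held, hA]
    rw [hcolheld, hcolheld, H']
  -- the columns
  have s₄ := learn_grid_route (K := K₁ ⊓ K₃) (act := fun (_ : Fin n) _ => True)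
    (loc := fun j _ => h j) (dst := fun j ω => g (ω.σ.symm j)) (val := fun j ω => ω.col j)
    hr hL hLB hrL (by
      rw [Nat.card_fin]
      exact hn.trans (Nat.pow_le_pow_right two_pos (by omega))) h₄
    (fun v => le_ker_held fun ω ω' hω j _ hj => by
      subst hj
      refine ⟨trivial, rfl, ?_⟩
      simp only [(hσ hω.1).1, hcol hω.2])
    (fun ω v => by simpa using hh v)
    (fun ω v => by
      refine (Set.ncard_le_ncard_of_injOn ω.σ.symm ?_ (fun _ _ _ _ h => ω.σ.symm.injective h)
        (Set.toFinite _)).trans (hg v)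
      exact fun i hi => hi.2)
  have t₁ := (s₁.par s₂).keep
  have t₂ := t₁.trans ((s₃.anti inf_le_right).keep)
  have t₃ := t₂.trans ((s₄.anti (le_inf (inf_le_left.trans (inf_le_right.trans inf_le_left))
    inf_le_right)).keep)
  refine (t₃.mono fun w => le_gather fun u hu => ?_).mono_time (by rw [gridTime]; omega)
  subst hu
  intro ω ω' hω
  have h1 : ω.σ u = ω'.σ u := congrArg (fun z => z.1.1) (hrep hω.1.1.1)
  obtain ⟨-, -, h3⟩ := held_transfer hω.2 (p := ω.σ u) trivial (by simp)
  simp only [Setoid.ker_def]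
  rw [← h3, h1]

end Grid

end CorePeriphery

/-! ### The algorithm -/

namespace CorePeriphery

/-! ### Lengths of the messages. -/

section Sizes

variable {n L d t : ℕ} {R : Type u} {D : Finset R}

theorem card_pair_le (hn : n ≤ 2 ^ L) (hD : D.card ≤ 2 ^ (d * L)) :
    Nat.card (Fin n × D) ≤ 2 ^ (L * (d + 1)) := by
  rw [Nat.card_prod, Nat.card_fin, Nat.card_eq_fintype_card, Fintype.card_coe, Nat.mul_succ,
    pow_add, mul_comm, mul_comm L d]
  exact Nat.mul_le_mul hD hn

theorem card_products_le (hD : D.card ≤ 2 ^ (d * L)) : Nat.card (D × D) ≤ 2 ^ (L * (2 * d)) := by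
  rw [Nat.card_prod, Nat.card_eq_fintype_card, Fintype.card_coe,
    show L * (2 * d) = d * L + d * L by ring, pow_add]
  exact Nat.mul_le_mul hD hD

theorem card_sparseFun_le_pow {Y : Type*} [Finite Y] {x : ℕ} (hL : 0 < L) (hn : n ≤ 2 ^ L)
    (hY : Nat.card Y ≤ 2 ^ (L * x)) (t : ℕ) :
    Nat.card (SparseFun (Fin n) Y t) ≤ 2 ^ (L * ((x + 2) * t)) := by
  refine (card_sparseFun_le t).trans ?_
  rw [← mul_assoc, pow_mul, Nat.card_fin]
  refine Nat.pow_le_pow_left ?_ t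
  have h1 : n * Nat.card Y ≤ 2 ^ (L * (x + 1)) := by
    rw [Nat.mul_succ, pow_add, mul_comm]
    exact Nat.mul_le_mul hY hn
  have h2 : 2 ^ 1 ≤ 2 ^ L := Nat.pow_le_pow_right two_pos hL
  have h3 : 0 < 2 ^ (L * (x + 1)) := by positivity
  rw [show L * (x + 2) = L * (x + 1) + L by ring, pow_add]
  nlinarith

end Sizes

/-! ### The number of rounds is linear in `k`. -/

/-- The factor in the number of rounds. -/
noncomputable def roundFactor (α : ℝ) (β γ d q : ℕ) : ℕ :=
  2 * ((2 * d + 2) * (q + 1) * hostTime α β γ) +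
    β * gridTime (hostLoad α γ) q ((2 * d + 2) * (q + 1)) (2 * d)

theorem routeTime_mul_le (D c c' : ℕ) {k : ℕ} (hk : 0 < k) :
    routeTime (D * k) c (D * k + c') ≤ k * routeTime D c (D + c') := by
  obtain ⟨k, rfl⟩ := Nat.exists_eq_succ_of_ne_zero hk.ne'
  refine Nat.le.intro (k := k * (12 * c + 8 * c')) ?_
  simp only [routeTime, Nat.succ_eq_add_one]
  ring

theorem routeTime_mul_le' (D x c c' : ℕ) {k : ℕ} (hk : 0 < k) :
    routeTime D (x * k + c) c' ≤ k * routeTime D (x + c) c' := by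
  obtain ⟨k, rfl⟩ := Nat.exists_eq_succ_of_ne_zero hk.ne'
  refine Nat.le.intro (k := k * (12 * c * (D + 1) + 8 * c')) ?_
  simp only [routeTime, Nat.succ_eq_add_one]
  ring

/-- `routeTime` contains the product of the load and the packet length, so only one of them may grow
with `k`. This is the case: whole rows and columns are long packets at constant load, and the pairs
are short packets at load `O(k)`. -/
theorem gridTime_mul_le (W q x y : ℕ) {k : ℕ} (hk : 0 < k) :
    gridTime W (q * k) (x * k) y ≤ k * gridTime W q x y := by
  have h1 := routeTime_mul_le' W x 5 (W + 2) hk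
  have h2 := routeTime_mul_le (W * q) (y + 5) 2 hk
  rw [mul_assoc] at h2
  rw [gridTime, gridTime, mul_add, mul_left_comm k]
  exact add_le_add (Nat.mul_le_mul_left 3 h1) h2

section Algorithm

variable {V : Type u} [Fintype V] {n : ℕ} {R : Type u} [Semiring R] {D : Finset R}
  {G : SimpleGraph V} {C : Set V} {α : ℝ} {β γ b d q k : ℕ}

/-- Every node can learn the column of the matrix that it needs. -/
theorem learn_column (hb : 1 ≤ b) (hV : Fintype.card V = n) (hn : 2 ≤ n) (hk : 0 < k)
    (h : IsCorePeriphery G C α β γ (b * Nat.clog 2 n))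
    (hD : D.card ≤ 2 ^ (d * Nat.clog 2 n)) :
    Learn G (b * Nat.clog 2 n) (roundFactor α β γ d q * k)
      (fun v => Setoid.ker fun ω : Instance V n D (q * k) => ω.input v)
      (fun v => Setoid.ker fun ω => ω.col (ω.σ v)) := by
  classical
  set L := Nat.clog 2 n with hLdef
  have hL : 0 < L := Nat.clog_pos one_lt_two hn
  have hLB : L ≤ b * L := Nat.le_mul_of_pos_left L hb
  have hnL : n ≤ 2 ^ L := Nat.le_pow_clog one_lt_two n
  have hVn : Nat.card V = n := by rw [Nat.card_eq_fintype_card, hV]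
  have : Nonempty V := by
    rw [← Fintype.card_pos_iff]
    omega
  obtain ⟨r, ι, g, hr, hrV, hg, hem, hup, hdown⟩ :=
    exists_hosting (hL.trans_le hLB) h (Instance V n D (q * k))
  -- In blocks of `L` bits, a report has length `(d + 2) + (d + 2) * (q * k)` and a column `(2 * d +
  -- 2) * (q * k)`; both are at most `x * k` since `k ≥ 1`.
  set x := (2 * d + 2) * (q + 1) with hx
  have hxk : x * k = (2 * d + 2) * (q * k) + (2 * d + 2) * k := by rw [hx]; ring
  have hdk : 2 * d + 2 ≤ (2 * d + 2) * k := Nat.le_mul_of_pos_right _ hk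
  have hpow : ∀ {a c : ℕ}, a ≤ 2 ^ (L * c) → c ≤ x * k → a ≤ 2 ^ (L * (x * k)) := fun h hc =>
    h.trans (Nat.pow_le_pow_right two_pos (Nat.mul_le_mul_left L hc))
  have hBpow : ∀ {a : ℕ}, a ≤ 2 ^ (L * (x * k)) → a ≤ 2 ^ (b * L * (x * k)) := fun h =>
    h.trans (Nat.pow_le_pow_right two_pos (Nat.mul_le_mul_right _ hLB))
  have hpair : Nat.card (Fin n × D) ≤ 2 ^ (L * (d + 1)) := card_pair_le hnL hD
  have hDcard : Nat.card D ≤ 2 ^ (L * d) := by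
    rw [Nat.card_eq_fintype_card, Fintype.card_coe, mul_comm]
    exact hD
  have hrow := card_sparseFun_le_pow hL hnL hDcard (q * k)
  have hcol := card_sparseFun_le_pow hL hnL (card_products_le hD) (q * k)
  have hle : (d + 2) * (q * k) ≤ (2 * d + 2) * (q * k) := Nat.mul_le_mul_right _ (by omega)
  have hrow' : Nat.card (Fin n × SparseFun (Fin n) D (q * k)) ≤
      2 ^ (L * (1 + (d + 2) * (q * k))) := by
    rw [Nat.card_prod, Nat.card_fin, mul_add, mul_one, pow_add]
    exact Nat.mul_le_mul hnL hrow
  have hrep : Nat.card ((Fin n × D) × (Fin n × SparseFun (Fin n) D (q * k))) ≤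
      2 ^ (L * (d + 1 + (1 + (d + 2) * (q * k)))) := by
    rw [Nat.card_prod, mul_add, pow_add]
    exact Nat.mul_le_mul hpair hrow'
  have s₁ := hup.large (hBpow (hpow hrep (by omega)))
    (fun v => Setoid.ker fun ω : Instance V n D (q * k) => ω.input v) Instance.report
    Instance.ker_input_le
  have s₂ := learn_simulate hem (learn_grid (W := hostLoad α γ) (x := x * k) (y := 2 * d) hr hL hLB
    ((hrV.trans hVn.le).trans hnL) hnL (Fintype.equivFinOfCardEq hV) g hg
    (hpow hpair (by omega)) (hpow hrow' (by omega)) (card_products_le hD)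
    (hpow hcol (by omega)))
    (K := gather (ι ∘ g) (Instance.report (V := V) (n := n) (D := D) (t := q * k)))
    fun x => le_gather fun u hu => by
      subst hu
      exact gather_le (dst := ι ∘ g) u
  have s₃ := hdown.large (hBpow (hpow hcol (by omega)))
    (pull ι (gather g fun u (ω : Instance V n D (q * k)) => ω.col (ω.σ u)))
    (fun u ω => ω.col (ω.σ u)) fun u => (pull_le (g u)).trans (gather_le u)
  refine ((s₁.trans (s₂.trans s₃)).mono fun v => gather_le (dst := id) v).mono_time ?_
  have h1 := Nat.mul_le_mul_right β (gridTime_mul_le (hostLoad α γ) q x (2 * d) hk)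
  calc x * k * hostTime α β γ + (gridTime (hostLoad α γ) (q * k) (x * k) (2 * d) * β +
        x * k * hostTime α β γ)
      ≤ x * k * hostTime α β γ + (k * gridTime (hostLoad α γ) q x (2 * d) * β +
        x * k * hostTime α β γ) := by gcongr
    _ = roundFactor α β γ d q * k := by rw [roundFactor, ← hx]; ring

/-- A deterministic algorithm for the task: all routing is done with colourings that the nodes
compute from common knowledge, so that no coins are needed. -/
theorem exists_algorithm (hb : 1 ≤ b) (hV : Fintype.card V = n)
    (h : IsCorePeriphery G C α β γ (b * Nat.clog 2 n))
    (hD : D.card ≤ 2 ^ (d * Nat.clog 2 n)) :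
    ∃ 𝒜 : CongestAlgorithm G (b * Nat.clog 2 n) (VMMInput n R) Unit R,
      ∀ (ω : Instance V n D (q * k)) c,
        SolvesVMM 𝒜 ω.σ ω.τ ω.s ω.A (roundFactor α β γ d q * k) c := by
  have : Inhabited R := ⟨0⟩
  suffices H : ∃ K' : V → Setoid (Instance V n D (q * k)),
      Learn G (b * Nat.clog 2 n) (roundFactor α β γ d q * k)
        (fun v => Setoid.ker fun ω : Instance V n D (q * k) => ω.input v) K' ∧
      ∀ v, K' v ≤ Setoid.ker fun ω => (ω.s ᵥ* ω.A) (ω.σ v) by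
    obtain ⟨K', hK, hout⟩ := H
    obtain ⟨𝒜, h𝒜⟩ := hK.exists_algorithm (fun v ω => (ω.s ᵥ* ω.A) (ω.σ v)) hout
    exact ⟨𝒜, fun ω c v => h𝒜 ω c v⟩
  -- For `n < 2` the bandwidth is zero, but a single node already holds the whole input.
  rcases Nat.lt_or_ge n 2 with hn | hn
  · refine ⟨_, Learn.of_le le_rfl _, fun v ω ω' hω => ?_⟩
    have : Subsingleton (Fin n) := Fin.subsingleton_iff_le_one.2 (Nat.le_of_lt_succ hn)
    have h1 : ω.s = ω'.s := funext fun i => by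
      rw [Subsingleton.elim i (ω.σ v)]
      have h2 : ω.s (ω.σ v) = ω'.s (ω'.σ v) := congrArg VMMInput.entry hω
      rw [h2, Subsingleton.elim (ω'.σ v) (ω.σ v)]
    have h2 : ω.A = ω'.A := by
      funext i
      rw [Subsingleton.elim i (ω.τ v)]
      have h2 : ω.A (ω.τ v) = ω'.A (ω'.τ v) := congrArg VMMInput.row hω
      rw [h2, Subsingleton.elim (ω'.τ v) (ω.τ v)]
    simp only [Setoid.ker_def, h1, h2, Subsingleton.elim (ω'.σ v) (ω.σ v)]
  -- For `k = 0` no round is available, but the matrix vanishes.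
  · rcases Nat.eq_zero_or_pos k with rfl | hk
    · refine ⟨_, Learn.of_le le_rfl _, fun v ω ω' _ => ?_⟩
      have hA : ∀ ω : Instance V n D (q * 0), ω.A = 0 := fun ω => by
        refine Matrix.ext fun i j => ?_
        by_contra hij
        have h1 : {j | ω.A i j ≠ 0}.ncard = 0 := Nat.le_zero.1 (ω.sparse.1 i)
        rw [Set.ncard_eq_zero (Set.toFinite _)] at h1
        exact Set.eq_empty_iff_forall_notMem.1 h1 j hij
      simp only [Setoid.ker_def, hA, Matrix.vecMul_zero, Pi.zero_apply]
    · refine ⟨_, learn_column hb hV hn hk h hD, fun v ω ω' hω => ?_⟩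
      have hω' : ω.col (ω.σ v) = ω'.col (ω'.σ v) := hω
      simp only [Setoid.ker_def, Instance.vecMul_eq, hω']

end Algorithm

theorem coinProb_eq_one {V : Type u} {E : (V → Unit) → Prop} (h : ∀ ω, E ω) : coinProb E = 1 := by
  have : Nat.card {ω : V → Unit // E ω} = 1 := by
    rw [Nat.card_eq_one_iff_unique]
    exact ⟨inferInstance, ⟨⟨fun _ => (), h _⟩⟩⟩
  simp [coinProb, this]

end CorePeriphery

theorem mainTheorem6 (α : ℝ) (β γ b d q a : ℕ) (hb : 1 ≤ b) :
    ∃ K : ℕ, ∀ (V : Type u) [Fintype V] (n : ℕ), Fintype.card V = n →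
      ∀ (G : SimpleGraph V) (C : Set V),
        IsCorePeriphery G C α β γ (b * Nat.clog 2 n) →
      ∀ (R : Type u) [Semiring R] (D : Finset R), D.card ≤ 2 ^ (d * Nat.clog 2 n) →
      ∀ k : ℕ,
        ∃ (Coin : Type) (_ : Fintype Coin) (_ : Nonempty Coin)
          (𝒜 : CongestAlgorithm G (b * Nat.clog 2 n) (VMMInput n R) Coin R),
          ∀ (σ τ : V ≃ Fin n) (s : Fin n → R) (A : Matrix (Fin n) (Fin n) R),
            (∀ i, s i ∈ D) → (∀ i j, A i j ∈ D) → IsSparse (q * k) A →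
              1 - 1 / (n : ℝ) ^ a ≤ coinProb (SolvesVMM 𝒜 σ τ s A (K * k)) := by
  refine ⟨CorePeriphery.roundFactor α β γ d q, ?_⟩
  intro V _ n hV G C h R _ D hD k
  obtain ⟨𝒜, h𝒜⟩ := CorePeriphery.exists_algorithm (q := q) (k := k) hb hV h hD
  refine ⟨Unit, inferInstance, inferInstance, 𝒜, fun σ τ s A hs hA hsp => ?_⟩
  rw [CorePeriphery.coinProb_eq_one fun c => h𝒜 ⟨σ, τ, s, A, hs, hA, hsp⟩ c]
  exact sub_le_self 1 (by positivity)
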